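/- Conventions. A polytope $P\subset\mathbb{R}^n$ is the convex hull of a finite set of points; it need not be full-dimensional. For $A\subseteq\mathbb{R}^n$, $\mathrm{Lin}\,A$ is the linear span of the differences of points of $A$, and $\dim A=\dim \mathrm{Lin}\,A$. A (nonempty) face of $P$ is a nonempty set $P^\psi$ of the points of $P$ at which a linear functional $\psi$ is maximal on $P$; a $\psi$ with $F=P^\psi$ is called a normal covector of $F$. A $k$-face is a face of dimension $k$, a vertex is a $0$-face, and a facet is a face of dimension $\dim P-1$. A simplex is the convex hull of affinely independent points. A frame is an ordered basis $B=(v_1,\dots,v_n)$ of $\mathbb{R}^n$. Put $V_k=\mathrm{span}(v_1,\dots,v_k)$ and let $\pi_k\colon\mathbb{R}^n\to V_k$ be the projection that fixes $v_i$ for $i\le k$ and kills $v_i$ for $i>k$. The frame is $P$-admissible if for every $k$ and every $k$-face $F$ of $P$, $\pi_k$ restricts to a linear isomorphism $\mathrm{Lin}\,F\to V_k$; let $\sigma_k^F$ be its inverse. The face $F$ is then oriented by $\beta_F=\sigma_k^F(v_1)\wedge\dots\wedge\sigma_k^F(v_k)$ (and $\beta_F=1$ if $k=0$). A facet $E$ of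 $F$ is in the source (resp. target) of $F$ if there are $v\in\mathrm{Lin}\,F$ and a normal covector $\psi$ of $E$ in $F$ with $\psi(v)<0$ (resp. $\psi(v)>0$) and $\beta_F=\lambda\,\beta_E\wedge v$ for some $\lambda>0$. For $k<\dim F$, the $k$-source (resp. $k$-target) of $F$ is the set of $k$-faces $E$ of $F$ such that $\pi_{k+1}(E)$ is a facet of $\pi_{k+1}(F)$ and lies in its source (resp. target). A cellular $k$-string is a finite sequence $F_1,\dots,F_m$ of faces of $P$ of dimension greater than $k$ such that, for each $1\le i<m$, the $k$-target of $F_i$ and the $k$-source of $F_{i+1}$ have a common element. A $k$-loop is a cellular $k$-string with $F_i=F_j$ for some $i\neq j$. We say that $P$ admits a frame inducing a $k$-loop if for some $P$-admissible frame there is a $k$-loop in $P$, and that it admits a frame inducing a loop if this holds for some $k\ge 0$. A polytope is simplicial if all its facets are simplices. A vertex figure of $P$ is a section $P\cap H$ by a hyperplane $H$ that strictly separates some vertex of $P$ from all its other vertices. A polytope is simple if all its vertex figures are simplices. Statement. 1. Every polytope that has a $5$-dimensional simplex as a face admits a frame inducing a loop. 2. Every simplicial polytope of dimension at least $6$ admits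 a frame inducing a loop. 3. For every $k\ge 0$: if a vertex figure of a polytope $P$ admits a frame inducing a $k$-loop, then $P$ admits a frame inducing a $(k+1)$-loop. 4. Every simple polytope of dimension at least $6$ admits a frame inducing a loop. -/

import Mathlib

namespace FramedPolytope

/-- A polytope in `ℝⁿ`: the convex hull of a finite set of points. -/
def IsPolytope {n : ℕ} (P : Set (Fin n → ℝ)) : Prop :=
  ∃ s : Finset (Fin n → ℝ), P = convexHull ℝ (s : Set (Fin n → ℝ))

/-- The linear span `Lin P` of `P`, spanned by the differences of its points, is
`vectorSpan ℝ P`; its dimension is the dimension of (a nonempty) `P`. -/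
noncomputable def dim {n : ℕ} (P : Set (Fin n → ℝ)) : ℕ :=
  Module.finrank ℝ (vectorSpan ℝ P)

/-- `ψ` is a normal covector of `F` in `P`: the set `F` is the locus of `P` on which `ψ` is
maximal. -/
def IsNormalCovector {n : ℕ} (P F : Set (Fin n → ℝ)) (ψ : Module.Dual ℝ (Fin n → ℝ)) : Prop :=
  F = {x | x ∈ P ∧ ∀ y ∈ P, ψ y ≤ ψ x}

/-- The nonempty faces of `P` are the nonempty maximal loci of linear functionals. -/
def IsFace {n : ℕ} (P F : Set (Fin n → ℝ)) : Prop :=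
  F.Nonempty ∧ IsExposed ℝ P F

/-- A facet is a face of codimension one. -/
def IsFacet {n : ℕ} (P F : Set (Fin n → ℝ)) : Prop :=
  IsFace P F ∧ dim F + 1 = dim P

def IsVertex {n : ℕ} (P : Set (Fin n → ℝ)) (v : Fin n → ℝ) : Prop :=
  IsFace P {v}

/-- A simplex: the convex hull of finitely many affinely independent points. -/
def IsSimplex {n : ℕ} (S : Set (Fin n → ℝ)) : Prop :=
  ∃ (m : ℕ) (p : Fin m → (Fin n → ℝ)), AffineIndependent ℝ p ∧ S = convexHull ℝ (Set.range p)

/-- A polytope is simplicial if all its facets are simplices. -/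
def IsSimplicial {n : ℕ} (P : Set (Fin n → ℝ)) : Prop :=
  IsPolytope P ∧ ∀ F, IsFacet P F → IsSimplex F

/-- `Q` is a vertex figure of `P` at the vertex `v`: the section of `P` by a hyperplane
`{φ = c}` that strictly separates `v` from all the other vertices. -/
def IsVertexFigureAt {n : ℕ} (P : Set (Fin n → ℝ)) (v : Fin n → ℝ) (Q : Set (Fin n → ℝ)) : Prop :=
  IsVertex P v ∧ ∃ (φ : Module.Dual ℝ (Fin n → ℝ)) (c : ℝ), φ ≠ 0 ∧ φ v < c ∧
    (∀ w, IsVertex P w → w ≠ v → c < φ w) ∧ Q = P ∩ {x | φ x = c}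

/-- A polytope is simple if all its vertex figures are simplices. -/
def IsSimple {n : ℕ} (P : Set (Fin n → ℝ)) : Prop :=
  IsPolytope P ∧ ∀ v Q, IsVertexFigureAt P v Q → IsSimplex Q

/-- A frame of `ℝⁿ`: an ordered basis. The vector `v₁` of the usual indexing is `B 0`. -/
abbrev Frame (n : ℕ) := Module.Basis (Fin n) ℝ (Fin n → ℝ)

/-- `V_k`, the span of the first `k` vectors of the frame. -/
def frameSpan {n : ℕ} (B : Frame n) (k : ℕ) : Submodule ℝ (Fin n → ℝ) :=
  Submodule.span ℝ {x | ∃ i : Fin n, (i : ℕ) < k ∧ x = B i}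

/-- `π_k`, the projection of `ℝⁿ` onto `V_k` that kills the remaining vectors of the frame. -/
noncomputable def proj {n : ℕ} (B : Frame n) (k : ℕ) : (Fin n → ℝ) →ₗ[ℝ] (Fin n → ℝ) :=
  B.constr ℝ (fun i : Fin n => if (i : ℕ) < k then B i else 0)

/-- The frame is `P`-admissible: for each `k`-face `F` of `P`, the map `π_k` restricts to a
linear isomorphism from `Lin F` onto `V_k`. -/
def IsAdmissible {n : ℕ} (B : Frame n) (P : Set (Fin n → ℝ)) : Prop :=
  ∀ F, IsFace P F →
    Set.BijOn (proj B (dim F)) (vectorSpan ℝ F : Set (Fin n → ℝ)) (frameSpan B (dim F))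

/-- `β = σ(v₁) ∧ ⋯ ∧ σ(v_k)`, where `k = dim F` and `σ` is the inverse of
`π_k : Lin F → V_k`; here `w i = σ(B i)`. For `k = 0` this is `β = 1`. -/
def IsInducedOrientation {n : ℕ} (B : Frame n) (F : Set (Fin n → ℝ))
    (β : ExteriorAlgebra ℝ (Fin n → ℝ)) : Prop :=
  ∃ (k : ℕ) (w : Fin k → (Fin n → ℝ)), dim F = k ∧
    (∀ i, w i ∈ vectorSpan ℝ F) ∧
    (∀ (i : Fin k) (j : Fin n), (j : ℕ) = (i : ℕ) → proj B k (w i) = B j) ∧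
    β = ExteriorAlgebra.ιMulti ℝ k w

/-- `β` and `β'` define the same orientation. -/
def OrientEquiv {n : ℕ} (β β' : ExteriorAlgebra ℝ (Fin n → ℝ)) : Prop :=
  ∃ r : ℝ, 0 < r ∧ β = r • β'

/-- The facet `F` of `P` is in the source of `P`: the orientation of `F` is completed to that
of `P` by wedging on the right with an inner-pointing vector. -/
def IsSourceFacet {n : ℕ} (B : Frame n) (P F : Set (Fin n → ℝ)) : Prop :=
  IsFacet P F ∧ ∃ βP βF, IsInducedOrientation B P βP ∧ IsInducedOrientation B F βF ∧
    ∃ v ∈ vectorSpan ℝ P, ∃ ψ, IsNormalCovector P F ψ ∧ ψ v < 0 ∧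
      OrientEquiv βP (βF * ExteriorAlgebra.ι ℝ v)

/-- The facet `F` of `P` is in the target of `P`: as above, with an outer-pointing vector. -/
def IsTargetFacet {n : ℕ} (B : Frame n) (P F : Set (Fin n → ℝ)) : Prop :=
  IsFacet P F ∧ ∃ βP βF, IsInducedOrientation B P βP ∧ IsInducedOrientation B F βF ∧
    ∃ v ∈ vectorSpan ℝ P, ∃ ψ, IsNormalCovector P F ψ ∧ 0 < ψ v ∧
      OrientEquiv βP (βF * ExteriorAlgebra.ι ℝ v)

/-- The `k`-boundary of `P`: the `k`-faces whose image under `π_{k+1}` is a facet of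
`π_{k+1}(P)`. -/
def kBoundary {n : ℕ} (B : Frame n) (k : ℕ) (P : Set (Fin n → ℝ)) : Set (Set (Fin n → ℝ)) :=
  {F | IsFace P F ∧ dim F = k ∧ IsFacet (proj B (k + 1) '' P) (proj B (k + 1) '' F)}

/-- The `k`-source of `P`. -/
def kSource {n : ℕ} (B : Frame n) (k : ℕ) (P : Set (Fin n → ℝ)) : Set (Set (Fin n → ℝ)) :=
  {F | F ∈ kBoundary B k P ∧ IsSourceFacet B (proj B (k + 1) '' P) (proj B (k + 1) '' F)}

/-- The `k`-target of `P`. -/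
def kTarget {n : ℕ} (B : Frame n) (k : ℕ) (P : Set (Fin n → ℝ)) : Set (Set (Fin n → ℝ)) :=
  {F | F ∈ kBoundary B k P ∧ IsTargetFacet B (proj B (k + 1) '' P) (proj B (k + 1) '' F)}

/-- A cellular `k`-string of `P`, as a finite sequence of faces of dimension greater than `k`. -/
def IsCellularString {n : ℕ} (B : Frame n) (P : Set (Fin n → ℝ)) (k : ℕ) {m : ℕ}
    (F : Fin m → Set (Fin n → ℝ)) : Prop :=
  (∀ i, IsFace P (F i) ∧ k < dim (F i)) ∧
  ∀ i j : Fin m, (j : ℕ) = (i : ℕ) + 1 → (kTarget B k (F i) ∩ kSource B k (F j)).Nonempty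

/-- The frame induces a cellular `k`-loop on `P`: some cellular `k`-string has a repetition. -/
def HasLoop {n : ℕ} (B : Frame n) (P : Set (Fin n → ℝ)) (k : ℕ) : Prop :=
  ∃ (m : ℕ) (F : Fin m → Set (Fin n → ℝ)), IsCellularString B P k F ∧
    ∃ i j, i ≠ j ∧ F i = F j

/-- `P` admits a frame (of the ambient space, `P`-admissible) inducing a cellular `k`-loop. -/
def AdmitsLoop {n : ℕ} (P : Set (Fin n → ℝ)) (k : ℕ) : Prop :=
  ∃ B : Frame n, IsAdmissible B P ∧ HasLoop B P k

end FramedPolytope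

namespace FramedPolytope

open Set Module Filter Topology

variable {n : ℕ}

/-- The points of `P` at which `θ` is maximal. -/
def argmax (P : Set (Fin n → ℝ)) (θ : Dual ℝ (Fin n → ℝ)) : Set (Fin n → ℝ) :=
  {x | x ∈ P ∧ ∀ y ∈ P, θ y ≤ θ x}

theorem isFace_iff {P F : Set (Fin n → ℝ)} :
    IsFace P F ↔ F.Nonempty ∧ ∃ θ, F = argmax P θ := by
  constructor
  · rintro ⟨h, he⟩
    obtain ⟨l, hl⟩ := he h
    exact ⟨h, l.toLinearMap, hl⟩
  · rintro ⟨h, θ, hθ⟩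
    exact ⟨h, fun _ => ⟨LinearMap.toContinuousLinearMap θ, hθ⟩⟩

theorem IsFace.subset {P F : Set (Fin n → ℝ)} (h : IsFace P F) : F ⊆ P := by
  obtain ⟨-, θ, rfl⟩ := isFace_iff.1 h
  exact fun x hx => hx.1

theorem argmax_eq {P : Set (Fin n → ℝ)} {θ : Dual ℝ (Fin n → ℝ)} {x : Fin n → ℝ}
    (hx : x ∈ argmax P θ) : argmax P θ = {y | y ∈ P ∧ θ y = θ x} := by
  ext y
  constructor
  · exact fun hy => ⟨hy.1, le_antisymm (hx.2 y hy.1) (hy.2 x hx.1)⟩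
  · rintro ⟨hy, h⟩
    exact ⟨hy, fun z hz => h ▸ hx.2 z hz⟩

theorem convex_argmax {P : Set (Fin n → ℝ)} (hP : Convex ℝ P) (θ : Dual ℝ (Fin n → ℝ)) :
    Convex ℝ (argmax P θ) := by
  intro x hx y hy a b ha hb hab
  refine ⟨hP hx.1 hy.1 ha hb hab, fun z hz => ?_⟩
  have h1 := hx.2 z hz
  have h2 := hy.2 z hz
  simp only [map_add, map_smul, smul_eq_mul]
  calc θ z = a * θ z + b * θ z := by rw [← add_mul, hab, one_mul]
    _ ≤ _ := by gcongr

theorem convexHull_le {t : Set (Fin n → ℝ)} {θ : Dual ℝ (Fin n → ℝ)} {M : ℝ}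
    (h : ∀ w ∈ t, θ w ≤ M) : ∀ w ∈ convexHull ℝ t, θ w ≤ M :=
  fun _ hw => convexHull_min h (convex_halfSpace_le (LinearMap.isLinear θ) M) hw

theorem convexHull_lt {t : Set (Fin n → ℝ)} {θ : Dual ℝ (Fin n → ℝ)} {M : ℝ}
    (h : ∀ w ∈ t, θ w < M) : ∀ w ∈ convexHull ℝ t, θ w < M :=
  fun _ hw => convexHull_min h (convex_halfSpace_lt (LinearMap.isLinear θ) M) hw

/-- A functional that is constant on `E` and smaller at the generators outside of `E`
exposes `E`. -/
theorem argmax_convexHull {t E : Set (Fin n → ℝ)} {θ : Dual ℝ (Fin n → ℝ)} {M : ℝ}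
    (hE : Convex ℝ E) (hEt : E ⊆ convexHull ℝ t) (hne : E.Nonempty)
    (hM : ∀ x ∈ E, θ x = M) (hlt : ∀ w ∈ t, w ∉ E → θ w < M) :
    E = argmax (convexHull ℝ t) θ := by
  have hle : ∀ w ∈ convexHull ℝ t, θ w ≤ M := convexHull_le fun w hw => by
    by_cases h : w ∈ E
    · exact (hM w h).le
    · exact (hlt w hw h).le
  have key : convexHull ℝ t ⊆ {x | x ∈ E ∨ θ x < M} := by
    refine convexHull_min (fun w hw => or_iff_not_imp_left.2 (hlt w hw)) ?_
    have hle' : ∀ x : Fin n → ℝ, (x ∈ E ∨ θ x < M) → θ x ≤ M := by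
      rintro x (h | h)
      · exact (hM x h).le
      · exact h.le
    rw [convex_iff_forall_pos]
    intro x hx y hy a b ha hb hab
    by_cases hxE : x ∈ E
    · by_cases hyE : y ∈ E
      · exact Or.inl (hE hxE hyE ha.le hb.le hab)
      · right
        have h1 := hM x hxE
        have h2 : θ y < M := hy.resolve_left hyE
        simp only [map_add, map_smul, smul_eq_mul]
        calc a * θ x + b * θ y < a * M + b * M := by rw [h1]; gcongr
          _ = M := by rw [← add_mul, hab, one_mul]
    · right
      have h1 : θ x < M := hx.resolve_left hxE
      have h2 := hle' y hy
      simp only [map_add, map_smul, smul_eq_mul]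
      calc a * θ x + b * θ y < a * M + b * M :=
              add_lt_add_of_lt_of_le (mul_lt_mul_of_pos_left h1 ha)
                (mul_le_mul_of_nonneg_left h2 hb.le)
        _ = M := by rw [← add_mul, hab, one_mul]
  obtain ⟨e, he⟩ := hne
  ext x
  constructor
  · exact fun hx => ⟨hEt hx, fun y hy => (hM x hx).symm ▸ hle y hy⟩
  · rintro ⟨hx, hmax⟩
    rcases key hx with h | h
    · exact h
    · exact absurd (hmax e (hEt he)) (by rw [hM e he]; exact not_le.2 h)

theorem argmax_eq_convexHull {s : Set (Fin n → ℝ)} {θ : Dual ℝ (Fin n → ℝ)}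
    (hne : (argmax (convexHull ℝ s) θ).Nonempty) :
    argmax (convexHull ℝ s) θ = convexHull ℝ (s ∩ argmax (convexHull ℝ s) θ) := by
  obtain ⟨x, hx⟩ := hne
  have hsub : convexHull ℝ (s ∩ argmax (convexHull ℝ s) θ) ⊆ argmax (convexHull ℝ s) θ :=
    convexHull_min inter_subset_right (convex_argmax (convex_convexHull ℝ s) θ)
  have hlt : ∀ w ∈ s, w ∉ argmax (convexHull ℝ s) θ → θ w < θ x := by
    intro w hw hn
    have hw' := subset_convexHull ℝ s hw
    refine lt_of_le_of_ne (hx.2 w hw') fun h => hn ?_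
    rw [argmax_eq hx]
    exact ⟨hw', h⟩
  refine (argmax_convexHull (convex_convexHull ℝ _) (hsub.trans fun y hy => hy.1) ?_
    (M := θ x) ?_ ?_).symm
  · by_contra hem
    rw [not_nonempty_iff_eq_empty, convexHull_eq_empty] at hem
    refine lt_irrefl (θ x) (convexHull_lt (fun w hw => hlt w hw fun h => ?_) x hx.1)
    exact (hem ▸ (⟨hw, h⟩ : w ∈ s ∩ _) : w ∈ (∅ : Set _))
  · intro y hy
    have := hsub hy
    rw [argmax_eq hx] at this
    exact this.2
  · exact fun w hw hn => hlt w hw fun h => hn (subset_convexHull ℝ _ ⟨hw, h⟩)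

theorem IsPolytope.convex {P : Set (Fin n → ℝ)} (hP : IsPolytope P) : Convex ℝ P := by
  obtain ⟨s, rfl⟩ := hP
  exact convex_convexHull ℝ _

theorem IsFace.eq_convexHull {s F : Set (Fin n → ℝ)} (hF : IsFace (convexHull ℝ s) F) :
    F = convexHull ℝ (s ∩ F) := by
  obtain ⟨hne, θ, rfl⟩ := isFace_iff.1 hF
  exact argmax_eq_convexHull hne

theorem IsFace.isPolytope {P F : Set (Fin n → ℝ)} (hP : IsPolytope P) (hF : IsFace P F) :
    IsPolytope F := by
  classical
  obtain ⟨s, rfl⟩ := hP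
  exact ⟨{x ∈ s | x ∈ F}, by rw [Finset.coe_filter]; exact hF.eq_convexHull⟩

theorem IsFace.convex {P F : Set (Fin n → ℝ)} (hP : IsPolytope P) (hF : IsFace P F) :
    Convex ℝ F := (hF.isPolytope hP).convex

theorem IsFace.self {P : Set (Fin n → ℝ)} (h : P.Nonempty) : IsFace P P :=
  isFace_iff.2 ⟨h, 0, by simp [argmax]⟩

theorem IsPolytope.finite_faces {P : Set (Fin n → ℝ)} (hP : IsPolytope P) :
    {F | IsFace P F}.Finite := by
  obtain ⟨s, rfl⟩ := hP
  refine Set.Finite.subset (s.finite_toSet.finite_subsets.image (convexHull ℝ)) ?_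
  exact fun F hF => ⟨s ∩ F, inter_subset_left, (IsFace.eq_convexHull hF).symm⟩

theorem IsPolytope.argmax_nonempty {P : Set (Fin n → ℝ)} (hP : IsPolytope P)
    (hne : P.Nonempty) (θ : Dual ℝ (Fin n → ℝ)) : (argmax P θ).Nonempty := by
  obtain ⟨s, rfl⟩ := hP
  obtain ⟨x, hx, hmax⟩ := s.exists_max_image θ (by
    simpa using (convexHull_nonempty_iff (𝕜 := ℝ)).1 hne)
  exact ⟨x, subset_convexHull ℝ _ hx, convexHull_le hmax⟩

theorem IsPolytope.isFace_argmax {P : Set (Fin n → ℝ)} (hP : IsPolytope P)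
    (hne : P.Nonempty) (θ : Dual ℝ (Fin n → ℝ)) : IsFace P (argmax P θ) :=
  isFace_iff.2 ⟨hP.argmax_nonempty hne θ, θ, rfl⟩

theorem IsFace.trans {P F G : Set (Fin n → ℝ)} (hP : IsPolytope P) (hF : IsFace P F)
    (hG : IsFace F G) : IsFace P G := by
  obtain ⟨s, rfl⟩ := hP
  have hsub : G ⊆ F := hG.subset
  have hconv : Convex ℝ G := hG.convex (hF.isPolytope ⟨s, rfl⟩)
  obtain ⟨-, θ, hθ⟩ := isFace_iff.1 hF
  obtain ⟨⟨g, hg⟩, χ, hχ⟩ := isFace_iff.1 hG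
  have hgF : g ∈ argmax (convexHull ℝ (s : Set (Fin n → ℝ))) θ := hθ ▸ hsub hg
  have hgG : g ∈ argmax F χ := hχ ▸ hg
  have hev : ∀ᶠ K : ℝ in Filter.atTop, ∀ w ∈ s, w ∉ F → χ w - χ g < K * (θ g - θ w) := by
    rw [Finset.eventually_all]
    intro w hw
    by_cases hwF : w ∈ F
    · exact Filter.Eventually.of_forall fun _ h => absurd hwF h
    · have : 0 < θ g - θ w := by
        rw [sub_pos]
        refine lt_of_le_of_ne (hgF.2 w (subset_convexHull ℝ _ hw)) fun h => hwF ?_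
        rw [hθ, argmax_eq hgF]
        exact ⟨subset_convexHull ℝ _ hw, h⟩
      filter_upwards [(Filter.tendsto_id.atTop_mul_const this).eventually_gt_atTop
        (χ w - χ g)] with K hK _ using hK
  obtain ⟨K, hK⟩ := hev.exists
  refine isFace_iff.2 ⟨⟨g, hg⟩, K • θ + χ, ?_⟩
  refine argmax_convexHull hconv (hsub.trans hF.subset) ⟨g, hg⟩ (M := (K • θ + χ) g) ?_ ?_
  · intro x hx
    have h1 : θ x = θ g := by
      have := hsub hx
      rw [hθ, argmax_eq hgF] at this
      exact this.2
    have h2 : χ x = χ g := by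
      rw [hχ, argmax_eq hgG] at hx
      exact hx.2
    simp [h1, h2]
  · intro w hw hwG
    have hw' := subset_convexHull ℝ _ hw
    simp only [LinearMap.add_apply, LinearMap.smul_apply, smul_eq_mul]
    by_cases hwF : w ∈ F
    · have h1 : θ w = θ g := by
        have := hwF
        rw [hθ, argmax_eq hgF] at this
        exact this.2
      have h2 : χ w < χ g := by
        refine lt_of_le_of_ne (hgG.2 w hwF) fun h => hwG ?_
        rw [hχ, argmax_eq hgG]
        exact ⟨hwF, h⟩
      rw [h1]
      linarith
    · linarith [hK w hw hwF]

theorem IsFace.of_subset {P F G : Set (Fin n → ℝ)} (hF : IsFace P F) (hG : IsFace P G)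
    (h : G ⊆ F) : IsFace F G := by
  obtain ⟨⟨g, hg⟩, θ, hθ⟩ := isFace_iff.1 hG
  refine isFace_iff.2 ⟨⟨g, hg⟩, θ, ?_⟩
  have hg' : g ∈ argmax P θ := hθ ▸ hg
  have hgF : g ∈ argmax F θ := ⟨h hg, fun y hy => hg'.2 y (hF.subset hy)⟩
  rw [argmax_eq hgF]
  ext x
  constructor
  · intro hx
    refine ⟨h hx, ?_⟩
    rw [hθ, argmax_eq hg'] at hx
    exact hx.2
  · rintro ⟨hx, hx'⟩
    rw [hθ, argmax_eq hg']
    exact ⟨hF.subset hx, hx'⟩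

theorem vectorSpan_convexHull (s : Set (Fin n → ℝ)) :
    vectorSpan ℝ (convexHull ℝ s) = vectorSpan ℝ s := by
  rw [← direction_affineSpan, affineSpan_convexHull, direction_affineSpan]

theorem mem_vectorSpan_eq_zero {A : Set (Fin n → ℝ)} {θ : Dual ℝ (Fin n → ℝ)} {M : ℝ}
    (h : ∀ x ∈ A, θ x = M) {u : Fin n → ℝ} (hu : u ∈ vectorSpan ℝ A) : θ u = 0 := by
  have : vectorSpan ℝ A ≤ LinearMap.ker θ := by
    refine Submodule.span_le.2 ?_
    rintro _ ⟨x, hx, y, hy, rfl⟩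
    simp [h x hx, h y hy]
  exact this hu

theorem IsFace.apply_vectorSpan {P F : Set (Fin n → ℝ)} {θ : Dual ℝ (Fin n → ℝ)}
    (hF : F = argmax P θ) {u : Fin n → ℝ} (hu : u ∈ vectorSpan ℝ F) : θ u = 0 := by
  have : vectorSpan ℝ F ≤ LinearMap.ker θ := by
    refine Submodule.span_le.2 ?_
    rintro _ ⟨x, hx, y, hy, rfl⟩
    rw [hF] at hx hy
    have := argmax_eq hx ▸ hy
    simp [this.2]
  exact this hu

theorem vsub_mem {A : Set (Fin n → ℝ)} {x y : Fin n → ℝ} (hx : x ∈ A) (hy : y ∈ A) :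
    x - y ∈ vectorSpan ℝ A := vsub_mem_vectorSpan ℝ hx hy

/-- Two faces, one in the other, with the same linear span are equal. -/
theorem IsFace.eq_of_vectorSpan_le {P F : Set (Fin n → ℝ)} (hF : IsFace P F)
    (h : vectorSpan ℝ P ≤ vectorSpan ℝ F) : F = P := by
  refine hF.subset.antisymm fun x hx => ?_
  obtain ⟨⟨g, hg⟩, θ, hθ⟩ := isFace_iff.1 hF
  have hg' : g ∈ argmax P θ := hθ ▸ hg
  rw [hθ, argmax_eq hg']
  refine ⟨hx, ?_⟩
  have := IsFace.apply_vectorSpan hθ (h (vsub_mem hx hg'.1))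
  rwa [map_sub, sub_eq_zero] at this

theorem dim_mono {A C : Set (Fin n → ℝ)} (h : A ⊆ C) : dim A ≤ dim C :=
  Submodule.finrank_mono (vectorSpan_mono ℝ h)

theorem IsFace.eq_of_dim_le {P F : Set (Fin n → ℝ)} (hF : IsFace P F) (h : dim P ≤ dim F) :
    F = P :=
  hF.eq_of_vectorSpan_le
    (Submodule.eq_of_le_of_finrank_le (vectorSpan_mono ℝ hF.subset) h).ge

/-- A polytope is the convex hull of its vertices. -/
theorem IsPolytope.exists_vertices {P : Set (Fin n → ℝ)} (hP : IsPolytope P) :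
    ∃ t : Finset (Fin n → ℝ), P = convexHull ℝ (t : Set (Fin n → ℝ)) ∧ ∀ x ∈ t, IsVertex P x := by
  classical
  have hex : ∃ m, ∃ s : Finset (Fin n → ℝ), s.card = m ∧
      P = convexHull ℝ (s : Set (Fin n → ℝ)) := by
    obtain ⟨s, hs⟩ := hP
    exact ⟨_, s, rfl, hs⟩
  obtain ⟨t, hcard, ht⟩ := Nat.find_spec hex
  refine ⟨t, ht, fun x hx => ?_⟩
  have hnot : x ∉ convexHull ℝ ((t.erase x : Finset _) : Set (Fin n → ℝ)) := by
    intro hmem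
    refine Nat.find_min hex (m := (t.erase x).card) ?_ ⟨_, rfl, ?_⟩
    · rw [← hcard]
      exact Finset.card_erase_lt_of_mem hx
    · rw [ht]
      refine (convexHull_min (fun y hy => ?_) (convex_convexHull ℝ _)).antisymm
        (convexHull_mono (by simp))
      by_cases h : y = x
      · exact h ▸ hmem
      · exact subset_convexHull ℝ _ (by simpa [h] using hy)
  obtain ⟨f, u, hf, hu⟩ := geometric_hahn_banach_closed_point (convex_convexHull ℝ _)
    ((t.erase x).finite_toSet.isClosed_convexHull ℝ) hnot
  refine isFace_iff.2 ⟨singleton_nonempty x, f.toLinearMap, ?_⟩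
  rw [ht]
  refine argmax_convexHull (convex_singleton x) (by simpa using subset_convexHull ℝ _ hx)
    (singleton_nonempty x) (M := f x) (by simp) ?_
  intro w hw hwx
  exact (hf w (subset_convexHull ℝ _ (by simpa using ⟨hw, hwx⟩))).trans hu

theorem IsVertex.mem_of_eq_convexHull {s : Set (Fin n → ℝ)} {v : Fin n → ℝ}
    (hv : IsVertex (convexHull ℝ s) v) : v ∈ s := by
  by_contra h
  have := IsFace.eq_convexHull hv
  rw [inter_singleton_eq_empty.2 h, convexHull_empty] at this
  exact singleton_ne_empty v this

theorem IsPolytope.exists_facet {P : Set (Fin n → ℝ)} (hP : IsPolytope P) (hdim : 0 < dim P) :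
    ∃ F, IsFacet P F := by
  have hne : P.Nonempty := by
    by_contra h
    rw [not_nonempty_iff_eq_empty] at h
    rw [h, dim, vectorSpan_empty, finrank_bot] at hdim
    exact lt_irrefl _ hdim
  have hproper : {F | IsFace P F ∧ F ≠ P}.Nonempty := by
    obtain ⟨t, ht, hv⟩ := hP.exists_vertices
    obtain ⟨v, hvt⟩ : t.Nonempty := by
      rw [Finset.nonempty_iff_ne_empty]
      rintro rfl
      simp [ht] at hne
    refine ⟨{v}, hv v hvt, fun h => ?_⟩
    rw [← h, dim, vectorSpan_singleton, finrank_bot] at hdim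
    exact lt_irrefl _ hdim
  obtain ⟨F, ⟨hF, hFP⟩, hmax⟩ := Set.exists_max_image _ dim
    (hP.finite_faces.subset fun F hF => hF.1) hproper
  refine ⟨F, hF, ?_⟩
  have hlt : dim F < dim P := lt_of_not_ge fun h => hFP (hF.eq_of_dim_le h)
  by_contra hcon
  have hlt2 : dim F + 1 < dim P := by omega
  obtain ⟨⟨g, hg⟩, θ, hθ⟩ := isFace_iff.1 hF
  have hg' : g ∈ argmax P θ := hθ ▸ hg
  have hconst : ∀ w ∈ P, w ∉ F → θ w < θ g := fun w hw hwF =>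
    lt_of_le_of_ne (hg'.2 w hw) fun h => hwF (by rw [hθ, argmax_eq hg']; exact ⟨hw, h⟩)
  obtain ⟨p, hp, hpF⟩ : ∃ p ∈ P, p ∉ F := by
    by_contra h
    push Not at h
    exact hFP (hF.subset.antisymm h)
  set W : Submodule ℝ (Fin n → ℝ) := vectorSpan ℝ F ⊔ Submodule.span ℝ {p - g} with hW
  obtain ⟨q, hq, hqW⟩ : ∃ q ∈ P, q - g ∉ W := by
    by_contra h
    push Not at h
    have h1 : vectorSpan ℝ P ≤ W := by
      rw [vectorSpan_eq_span_vsub_set_right ℝ (hF.subset hg)]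
      refine Submodule.span_le.2 ?_
      rintro _ ⟨x, hx, rfl⟩
      exact h x hx
    have h2 := Submodule.finrank_mono h1
    have h3 : finrank ℝ W ≤ finrank ℝ (vectorSpan ℝ F) + finrank ℝ (Submodule.span ℝ {p - g}) :=
      Submodule.finrank_add_le_finrank_add_finrank _ _
    have h4 : finrank ℝ (Submodule.span ℝ {p - g}) ≤ 1 := by
      simpa using finrank_span_le_card (R := ℝ) ({p - g} : Set (Fin n → ℝ))
    have : dim P ≤ dim F + 1 := h2.trans (h3.trans (Nat.add_le_add_left h4 _))
    omega
  obtain ⟨χ₀, hχ₀, hχW⟩ := Submodule.exists_le_ker_of_notMem hqW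
  obtain ⟨χ, hχW, hχq⟩ : ∃ χ : Dual ℝ (Fin n → ℝ), W ≤ LinearMap.ker χ ∧ 0 < χ (q - g) := by
    rcases lt_or_gt_of_ne hχ₀ with h | h
    · exact ⟨-χ₀, fun x hx => by simpa using hχW hx, by simpa using h⟩
    · exact ⟨χ₀, hχW, h⟩
  have hχF : ∀ x ∈ F, χ x = χ g := fun x hx => by
    have : χ (x - g) = 0 := hχW (Submodule.mem_sup_left (vsub_mem hx hg))
    rwa [map_sub, sub_eq_zero] at this
  have hχp : χ p = χ g := by
    have : χ (p - g) = 0 :=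
      hχW (Submodule.mem_sup_right (Submodule.mem_span_singleton_self _))
    rwa [map_sub, sub_eq_zero] at this
  rw [map_sub, sub_pos] at hχq
  have hP0 := hP
  obtain ⟨s, hs⟩ := hP
  classical
  obtain ⟨w₀, hw₀, hmin⟩ := Finset.exists_min_image {w ∈ s | χ g < χ w}
    (fun w => (θ g - θ w) / (χ w - χ g)) (by
      by_contra h
      rw [Finset.not_nonempty_iff_eq_empty, Finset.filter_eq_empty_iff] at h
      exact not_le.2 hχq (convexHull_le (fun w hw => not_lt.1 (h hw)) q (hs ▸ hq)))
  rw [Finset.mem_filter] at hw₀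
  have hsP : ∀ w ∈ s, w ∈ P := fun w hw => hs ▸ subset_convexHull ℝ _ hw
  have hw₀F : w₀ ∉ F := fun h => hw₀.2.ne' (hχF w₀ h)
  set t := (θ g - θ w₀) / (χ w₀ - χ g) with ht
  have ht0 : 0 ≤ t := div_nonneg (sub_nonneg.2 (hg'.2 _ (hsP _ hw₀.1))) (sub_nonneg.2 hw₀.2.le)
  have htw : θ w₀ + t * χ w₀ = θ g + t * χ g := by
    have := sub_pos.2 hw₀.2
    have h2 : t * (χ w₀ - χ g) = θ g - θ w₀ := div_mul_cancel₀ _ this.ne'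
    linarith
  have hle : ∀ w ∈ s, (θ + t • χ) w ≤ (θ + t • χ) g := by
    intro w hw
    simp only [LinearMap.add_apply, LinearMap.smul_apply, smul_eq_mul]
    by_cases h : χ g < χ w
    · have h1 := hmin w (Finset.mem_filter.2 ⟨hw, h⟩)
      rw [le_div_iff₀ (sub_pos.2 h)] at h1
      linarith
    · have h1 := hg'.2 w (hsP w hw)
      have h2 := mul_le_mul_of_nonneg_left (not_lt.1 h) ht0
      linarith
  have hgmax : g ∈ argmax P (θ + t • χ) := ⟨hF.subset hg, fun y hy => convexHull_le hle y (hs ▸ hy)⟩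
  have hface : IsFace P (argmax P (θ + t • χ)) := hP0.isFace_argmax hne _
  have hsub : F ⊆ argmax P (θ + t • χ) := by
    intro x hx
    rw [argmax_eq hgmax]
    refine ⟨hF.subset hx, ?_⟩
    have h1 : θ x = θ g := by
      rw [hθ, argmax_eq hg'] at hx
      exact hx.2
    simp [h1, hχF x hx]
  have hne' : argmax P (θ + t • χ) ≠ P := by
    intro h
    have : p ∈ argmax P (θ + t • χ) := by rwa [h]
    rw [argmax_eq hgmax] at this
    have h2 := this.2
    simp only [LinearMap.add_apply, LinearMap.smul_apply, smul_eq_mul, hχp] at h2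
    linarith [hconst p hp hpF]
  have heq := (hface.of_subset hF hsub).eq_of_dim_le (hmax _ ⟨hface, hne'⟩)
  refine hw₀F ?_
  rw [heq, argmax_eq hgmax]
  refine ⟨hsP _ hw₀.1, ?_⟩
  simpa using htw

theorem ιMulti_castSucc_mul {k : ℕ} (u : Fin (k + 1) → (Fin n → ℝ)) :
    ExteriorAlgebra.ιMulti ℝ k (fun i => u i.castSucc) * ExteriorAlgebra.ι ℝ (u (Fin.last k)) =
      ExteriorAlgebra.ιMulti ℝ (k + 1) u := by
  rw [ExteriorAlgebra.ιMulti_apply, ExteriorAlgebra.ιMulti_apply, List.ofFn_succ',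
    List.concat_eq_append, List.prod_append, List.prod_singleton]

theorem ιMulti_mul_ι {k : ℕ} (w : Fin k → (Fin n → ℝ)) (v : Fin n → ℝ) :
    ExteriorAlgebra.ιMulti ℝ k w * ExteriorAlgebra.ι ℝ v =
      ExteriorAlgebra.ιMulti ℝ (k + 1) (Fin.snoc w v : Fin (k + 1) → (Fin n → ℝ)) := by
  rw [← ιMulti_castSucc_mul]
  simp

theorem ι_mul_ιMulti_mul_ι {k : ℕ} (w : Fin k → (Fin n → ℝ)) (v : Fin n → ℝ) :
    ExteriorAlgebra.ι ℝ v * (ExteriorAlgebra.ιMulti ℝ k w * ExteriorAlgebra.ι ℝ v) = 0 := by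
  rw [ιMulti_mul_ι]
  have := ExteriorAlgebra.ιMulti_succ_apply (R := ℝ)
    (v := (Fin.cons v (Fin.snoc w v) : Fin (k + 1 + 1) → (Fin n → ℝ)))
  simp only [Fin.cons_zero, Matrix.vecTail, Function.comp_def, Fin.cons_succ] at this
  rw [← this]
  exact AlternatingMap.map_eq_zero_of_eq _ _ (i := 0) (j := Fin.succ (Fin.last k))
    (by simp) (Fin.succ_ne_zero _).symm

theorem ιMulti_mul_ι_congr {k : ℕ} (w w' : Fin k → (Fin n → ℝ)) (v : Fin n → ℝ)
    (h : ∀ i, ∃ c : ℝ, w i = w' i + c • v) :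
    ExteriorAlgebra.ιMulti ℝ k w * ExteriorAlgebra.ι ℝ v =
      ExteriorAlgebra.ιMulti ℝ k w' * ExteriorAlgebra.ι ℝ v := by
  induction k with
  | zero => rw [Subsingleton.elim w w']
  | succ k ih =>
    rw [ExteriorAlgebra.ιMulti_succ_apply, ExteriorAlgebra.ιMulti_succ_apply, mul_assoc, mul_assoc,
      ih (Matrix.vecTail w) (Matrix.vecTail w') (fun i => h i.succ)]
    obtain ⟨c, hc⟩ := h 0
    rw [hc, map_add, map_smul, add_mul, smul_mul_assoc, ι_mul_ιMulti_mul_ι, smul_zero, add_zero]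

theorem ιMulti_mul_ι_eq_zero {k : ℕ} (w : Fin k → (Fin n → ℝ)) {x : Fin n → ℝ}
    (hx : x ∈ Submodule.span ℝ (range w)) :
    ExteriorAlgebra.ιMulti ℝ k w * ExteriorAlgebra.ι ℝ x = 0 := by
  induction hx using Submodule.span_induction with
  | mem x hx =>
    obtain ⟨i, rfl⟩ := hx
    rw [ιMulti_mul_ι]
    exact AlternatingMap.map_eq_zero_of_eq _ _ (i := i.castSucc) (j := Fin.last k)
      (by simp) i.castSucc_lt_last.ne
  | zero => simp
  | add x y _ _ hx hy => rw [map_add, mul_add, hx, hy, add_zero]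
  | smul a x _ hx => rw [map_smul, mul_smul_comm, hx, smul_zero]

theorem ιMulti_basis_ne_zero (B : Frame n) {k : ℕ} (hk : k ≤ n) :
    ExteriorAlgebra.ιMulti ℝ k (fun i => B (Fin.castLE hk i)) ≠ 0 := by
  intro h
  let L : (Fin n → ℝ) →ₗ[ℝ] (Fin k → ℝ) := LinearMap.pi fun i => B.coord (Fin.castLE hk i)
  let f : (Fin n → ℝ) [⋀^Fin k]→ₗ[ℝ] ℝ := (Pi.basisFun ℝ (Fin k)).det.compLinearMap L
  have h1 := ExteriorAlgebra.liftAlternating_apply_ιMulti (R := ℝ) (Function.update 0 k f)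
    (fun i => B (Fin.castLE hk i))
  rw [h, map_zero, Function.update_self, AlternatingMap.compLinearMap_apply] at h1
  have h2 : (fun i : Fin k => L (B (Fin.castLE hk i))) = Pi.basisFun ℝ (Fin k) := by
    ext i j
    simp [L, Finsupp.single_apply, Pi.single_apply, eq_comm]
  rw [h2, Basis.det_self] at h1
  exact zero_ne_one h1

theorem proj_basis (B : Frame n) (k : ℕ) (i : Fin n) :
    proj B k (B i) = if (i : ℕ) < k then B i else 0 := by
  rw [proj, Basis.constr_basis]

theorem repr_proj (B : Frame n) (k : ℕ) (x : Fin n → ℝ) (i : Fin n) :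
    B.repr (proj B k x) i = if (i : ℕ) < k then B.repr x i else 0 := by
  have : B.coord i ∘ₗ proj B k = (if (i : ℕ) < k then (1 : ℝ) else 0) • B.coord i := by
    refine B.ext fun j => ?_
    simp only [LinearMap.comp_apply, proj_basis, LinearMap.smul_apply, Basis.coord_apply,
      Basis.repr_self, smul_eq_mul]
    by_cases hij : j = i
    · subst hij
      split_ifs <;> simp
    · split_ifs <;> simp [hij]
  have h2 := LinearMap.congr_fun this x
  simp only [LinearMap.comp_apply, Basis.coord_apply, LinearMap.smul_apply, smul_eq_mul] at h2
  rw [h2]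
  split_ifs <;> simp

theorem mem_frameSpan (B : Frame n) (k : ℕ) (x : Fin n → ℝ) :
    x ∈ frameSpan B k ↔ ∀ i : Fin n, k ≤ i → B.repr x i = 0 := by
  have : {x | ∃ i : Fin n, (i : ℕ) < k ∧ x = B i} = B '' {i : Fin n | (i : ℕ) < k} := by
    ext y
    simp [eq_comm]
  rw [frameSpan, this, Basis.mem_span_image]
  constructor
  · intro h i hi
    by_contra hne
    exact absurd (h (Finsupp.mem_support_iff.2 hne)) (not_lt.2 hi)
  · intro h i hi
    by_contra hlt
    exact (Finsupp.mem_support_iff.1 hi) (h i (not_lt.1 hlt))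

theorem finrank_frameSpan (B : Frame n) {k : ℕ} (hk : k ≤ n) : finrank ℝ (frameSpan B k) = k := by
  have : {x | ∃ i : Fin n, (i : ℕ) < k ∧ x = B i} = range (fun i : Fin k => B (Fin.castLE hk i)) := by
    ext y
    constructor
    · rintro ⟨i, hi, rfl⟩
      exact ⟨⟨i, hi⟩, rfl⟩
    · rintro ⟨i, rfl⟩
      exact ⟨Fin.castLE hk i, i.2, rfl⟩
  rw [frameSpan, this, finrank_span_eq_card]
  · simp
  · exact B.linearIndependent.comp _ (Fin.castLE_injective hk)

theorem proj_mem_frameSpan (B : Frame n) (k : ℕ) (x : Fin n → ℝ) : proj B k x ∈ frameSpan B k := by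
  rw [mem_frameSpan]
  intro i hi
  rw [repr_proj, if_neg (not_lt.2 hi)]

theorem proj_eq_self {B : Frame n} {k : ℕ} {x : Fin n → ℝ} (hx : x ∈ frameSpan B k) :
    proj B k x = x := by
  apply B.ext_elem
  intro i
  rw [repr_proj]
  split_ifs with h
  · rfl
  · exact ((mem_frameSpan B k x).1 hx i (not_lt.1 h)).symm

theorem proj_proj (B : Frame n) {k l : ℕ} (h : k ≤ l) (x : Fin n → ℝ) :
    proj B k (proj B l x) = proj B k x := by
  apply B.ext_elem
  intro i
  rw [repr_proj, repr_proj, repr_proj]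
  split_ifs <;> first | rfl | omega

theorem eq_proj_add {B : Frame n} {k : ℕ} (hk : k < n) {x : Fin n → ℝ}
    (hx : x ∈ frameSpan B (k + 1)) : x = proj B k x + B.repr x ⟨k, hk⟩ • B ⟨k, hk⟩ := by
  apply B.ext_elem
  intro i
  simp only [map_add, map_smul, Finsupp.add_apply, Finsupp.smul_apply, repr_proj, Basis.repr_self,
    Finsupp.single_apply, smul_eq_mul, Fin.ext_iff]
  rcases lt_trichotomy (i : ℕ) k with h | h | h
  · rw [if_pos h, if_neg h.ne', mul_zero, add_zero]
  · subst h
    simp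
  · rw [if_neg h.not_gt, if_neg h.ne, (mem_frameSpan B _ x).1 hx i h]
    simp

theorem vectorSpan_proj_image (B : Frame n) (k : ℕ) (A : Set (Fin n → ℝ)) :
    vectorSpan ℝ (proj B k '' A) = (vectorSpan ℝ A).map (proj B k) :=
  ((proj B k).toAffineMap.map_vectorSpan (s := A)).symm

theorem vectorSpan_proj_image_le (B : Frame n) (k : ℕ) (A : Set (Fin n → ℝ)) :
    vectorSpan ℝ (proj B k '' A) ≤ frameSpan B k := by
  rw [vectorSpan_proj_image]
  rintro _ ⟨x, -, rfl⟩
  exact proj_mem_frameSpan B k x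

/-- The projection `π_k` is a bijection from `Lin F` onto `V_k`, where `k = dim F`. -/
def AdmissibleAt (B : Frame n) (F : Set (Fin n → ℝ)) : Prop :=
  BijOn (proj B (dim F)) (vectorSpan ℝ F : Set (Fin n → ℝ)) (frameSpan B (dim F))

theorem dim_proj_image {B : Frame n} {E : Set (Fin n → ℝ)} (h : AdmissibleAt B E) {l : ℕ}
    (hl : dim E ≤ l) : dim (proj B l '' E) = dim E := by
  have hinj : Function.Injective ((proj B l).domRestrict (vectorSpan ℝ E)) := by
    intro x y hxy
    refine Subtype.ext (h.injOn x.2 y.2 ?_)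
    rw [← proj_proj B hl x, ← proj_proj B hl y]
    exact congrArg (proj B (dim E)) hxy
  have := LinearMap.finrank_range_of_inj hinj
  rwa [LinearMap.range_domRestrict, ← vectorSpan_proj_image] at this

/-- Common form of `IsSourceFacet` (`s = -1`) and `IsTargetFacet` (`s = 1`). -/
def IsSideFacet (s : ℝ) (B : Frame n) (P F : Set (Fin n → ℝ)) : Prop :=
  IsFacet P F ∧ ∃ βP βF, IsInducedOrientation B P βP ∧ IsInducedOrientation B F βF ∧
    ∃ v ∈ vectorSpan ℝ P, ∃ ψ, IsNormalCovector P F ψ ∧ 0 < s * ψ v ∧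
      OrientEquiv βP (βF * ExteriorAlgebra.ι ℝ v)

/-- The common form of the `k`-source (`s = -1`) and the `k`-target (`s = 1`). -/
def kSide (s : ℝ) (B : Frame n) (k : ℕ) (P : Set (Fin n → ℝ)) : Set (Set (Fin n → ℝ)) :=
  {F | F ∈ kBoundary B k P ∧ IsSideFacet s B (proj B (k + 1) '' P) (proj B (k + 1) '' F)}

theorem kTarget_eq (B : Frame n) (k : ℕ) (P : Set (Fin n → ℝ)) :
    kTarget B k P = kSide 1 B k P := by
  simp [kTarget, kSide, IsTargetFacet, IsSideFacet]

theorem kSource_eq (B : Frame n) (k : ℕ) (P : Set (Fin n → ℝ)) :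
    kSource B k P = kSide (-1) B k P := by
  simp [kSource, kSide, IsSourceFacet, IsSideFacet]

/-- Some functional that vanishes on the vectors of `B` after the `k`-th and whose sign on the
`k`-th one is that of `s` exposes `E` in `F`. -/
def Side (s : ℝ) (B : Fin n → (Fin n → ℝ)) (k : Fin n) (F E : Set (Fin n → ℝ)) : Prop :=
  ∃ θ : Dual ℝ (Fin n → ℝ), 0 < s * θ (B k) ∧ (∀ i, k < i → θ (B i) = 0) ∧ E = argmax F θ

theorem apply_proj {B : Frame n} {k : ℕ} {θ : Dual ℝ (Fin n → ℝ)}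
    (h : ∀ i : Fin n, k ≤ i → θ (B i) = 0) (x : Fin n → ℝ) : θ (proj B k x) = θ x := by
  have : θ ∘ₗ proj B k = θ := by
    refine B.ext fun i => ?_
    rw [LinearMap.comp_apply, proj_basis]
    split_ifs with hi
    · rfl
    · rw [map_zero, h i (not_lt.1 hi)]
  exact LinearMap.congr_fun this x

theorem mem_kSide_of_side {s : ℝ} {B : Frame n} {k : ℕ} (hk : k < n) {F E : Set (Fin n → ℝ)}
    (hE : IsFace F E) (hdE : dim E = k) (hdF : k < dim F) (hadm : AdmissibleAt B E)
    (h : Side s B ⟨k, hk⟩ F E) : E ∈ kSide s B k F := by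
  obtain ⟨θ, hpos, hzero, hθ⟩ := h
  have hθp : ∀ x, θ (proj B (k + 1) x) = θ x := apply_proj fun i hi => hzero i hi
  obtain ⟨e, he⟩ := hE.1
  have he' : e ∈ argmax F θ := hθ ▸ he
  have hargmax : proj B (k + 1) '' E = argmax (proj B (k + 1) '' F) θ := by
    ext y
    constructor
    · rintro ⟨x, hx, rfl⟩
      rw [hθ] at hx
      refine ⟨mem_image_of_mem _ hx.1, ?_⟩
      rintro _ ⟨z, hz, rfl⟩
      rw [hθp, hθp]
      exact hx.2 z hz
    · rintro ⟨⟨x, hx, rfl⟩, hmax⟩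
      refine ⟨x, ?_, rfl⟩
      rw [hθ]
      refine ⟨hx, fun z hz => ?_⟩
      have := hmax _ (mem_image_of_mem _ hz)
      rwa [hθp, hθp] at this
  have hface : IsFace (proj B (k + 1) '' F) (proj B (k + 1) '' E) :=
    isFace_iff.2 ⟨hE.1.image _, θ, hargmax⟩
  have hle := vectorSpan_proj_image_le B (k + 1) F
  have hsub : vectorSpan ℝ (proj B (k + 1) '' E) ≤ vectorSpan ℝ (proj B (k + 1) '' F) :=
    vectorSpan_mono ℝ (image_mono hE.subset)
  have hθE : ∀ u ∈ vectorSpan ℝ (proj B (k + 1) '' E), θ u = 0 :=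
    fun u hu => IsFace.apply_vectorSpan hargmax hu
  -- the lifts of the first `k` vectors of the frame
  have hlift : ∀ i : Fin k, ∃ w ∈ vectorSpan ℝ (proj B (k + 1) '' E),
      proj B k w = B (Fin.castLE hk.le i) := by
    intro i
    have hmem : B (Fin.castLE hk.le i) ∈ (frameSpan B (dim E) : Set (Fin n → ℝ)) :=
      Submodule.subset_span ⟨_, by rw [hdE]; exact i.2, rfl⟩
    obtain ⟨u, hu, hu'⟩ := hadm.surjOn hmem
    refine ⟨proj B (k + 1) u, ?_, ?_⟩
    · rw [vectorSpan_proj_image]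
      exact Submodule.mem_map_of_mem hu
    · rw [proj_proj B (Nat.le_succ k)]
      simpa only [hdE] using hu'
  choose w hwE hw using hlift
  have hwB : ∀ i, w i = B (Fin.castLE hk.le i) + B.repr (w i) ⟨k, hk⟩ • B ⟨k, hk⟩ := by
    intro i
    conv_lhs => rw [eq_proj_add hk (hle (hsub (hwE i))), hw]
  have hlast : B ⟨k, hk⟩ ∈ vectorSpan ℝ (proj B (k + 1) '' F) := by
    obtain ⟨x, hx, hxE⟩ : ∃ x ∈ F, x ∉ E := by
      by_contra hcon
      push Not at hcon
      have := dim_mono hcon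
      omega
    have hne : θ (x - e) ≠ 0 := by
      intro h0
      rw [map_sub, sub_eq_zero] at h0
      refine hxE ?_
      rw [hθ, argmax_eq he']
      exact ⟨hx, h0⟩
    set u := proj B (k + 1) (x - e) with hu
    have huF : u ∈ vectorSpan ℝ (proj B (k + 1) '' F) := by
      rw [vectorSpan_proj_image]
      exact Submodule.mem_map_of_mem (vsub_mem hx he'.1)
    obtain ⟨y, hy, hyu⟩ := hadm.surjOn (show proj B (dim E) u ∈
      (frameSpan B (dim E) : Set (Fin n → ℝ)) from proj_mem_frameSpan _ _ _)
    have hyE : proj B (k + 1) y ∈ vectorSpan ℝ (proj B (k + 1) '' E) := by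
      rw [vectorSpan_proj_image]
      exact Submodule.mem_map_of_mem hy
    have hdiff : u - proj B (k + 1) y =
        B.repr (u - proj B (k + 1) y) ⟨k, hk⟩ • B ⟨k, hk⟩ := by
      conv_lhs => rw [eq_proj_add hk (Submodule.sub_mem _ (hle huF) (hle (hsub hyE)))]
      rw [hdE] at hyu
      rw [map_sub, proj_proj B (Nat.le_succ k) y, hyu, sub_self, zero_add]
    have hc : B.repr (u - proj B (k + 1) y) ⟨k, hk⟩ ≠ 0 := by
      intro h0
      rw [h0, zero_smul] at hdiff
      apply hne
      rw [← hθp, ← hu, sub_eq_zero.1 hdiff]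
      exact hθE _ hyE
    have hmem := Submodule.sub_mem _ huF (hsub hyE)
    rw [hdiff] at hmem
    exact (Submodule.smul_mem_iff _ hc).1 hmem
  have hspan : vectorSpan ℝ (proj B (k + 1) '' F) = frameSpan B (k + 1) := by
    refine le_antisymm hle (Submodule.span_le.2 ?_)
    rintro _ ⟨i, hi, rfl⟩
    rcases Nat.lt_succ_iff_lt_or_eq.1 hi with hi | hi
    · have h1 := hwB ⟨i, hi⟩
      have h2 := Submodule.sub_mem _ (hsub (hwE ⟨i, hi⟩))
        (Submodule.smul_mem _ (B.repr (w ⟨i, hi⟩) ⟨k, hk⟩) hlast)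
      rwa [← eq_sub_of_add_eq h1.symm] at h2
    · have : i = ⟨k, hk⟩ := Fin.ext hi
      exact this ▸ hlast
  have hdpF : dim (proj B (k + 1) '' F) = k + 1 := by
    rw [dim, hspan, finrank_frameSpan B hk]
  have hdpE : dim (proj B (k + 1) '' E) = k := by
    rw [dim_proj_image hadm (by omega), hdE]
  have hfacet : IsFacet (proj B (k + 1) '' F) (proj B (k + 1) '' E) :=
    ⟨hface, by rw [hdpE, hdpF]⟩
  refine ⟨⟨hE, hdE, hfacet⟩, hfacet,
    ExteriorAlgebra.ιMulti ℝ (k + 1) (fun i => B (Fin.castLE hk i)),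
    ExteriorAlgebra.ιMulti ℝ k w, ?_, ?_, B ⟨k, hk⟩, hlast, θ, hargmax, hpos, 1, one_pos, ?_⟩
  · refine ⟨k + 1, _, hdpF, fun i => ?_, ?_, rfl⟩
    · rw [hspan]
      exact Submodule.subset_span ⟨_, i.2, rfl⟩
    · intro i j hij
      rw [proj_basis, Fin.val_castLE, if_pos i.2]
      congr 1
      exact Fin.ext hij.symm
  · refine ⟨k, w, hdpE, hwE, fun i j hij => ?_, rfl⟩
    rw [hw]
    congr 1
    exact Fin.ext hij.symm
  · rw [one_smul, ιMulti_mul_ι_congr w _ _ fun i => ⟨_, hwB i⟩]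
    exact (ιMulti_castSucc_mul _).symm

theorem side_of_mem_kSide {s : ℝ} {B : Frame n} {k : ℕ} (hk : k < n) {P F E : Set (Fin n → ℝ)}
    (hP : IsPolytope P) (hB : IsAdmissible B P) (hF : IsFace P F)
    (h : E ∈ kSide s B k F) : Side s B ⟨k, hk⟩ F E := by
  obtain ⟨⟨hE, hdE, -⟩, hfacet, βP, βF, hβP, hβF, v, hv, ψ, hψ, hpos, r, hr, hrβ⟩ := h
  have hEP : IsFace P E := hF.trans hP hE
  have hadm : AdmissibleAt B E := hB E hEP
  have hdpE : dim (proj B (k + 1) '' E) = k := by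
    rw [dim_proj_image hadm (by omega), hdE]
  have hdpF : dim (proj B (k + 1) '' F) = k + 1 := by
    rw [← hfacet.2, hdpE]
  have hle := vectorSpan_proj_image_le B (k + 1) F
  have hsub : vectorSpan ℝ (proj B (k + 1) '' E) ≤ vectorSpan ℝ (proj B (k + 1) '' F) :=
    vectorSpan_mono ℝ (image_mono hE.subset)
  have hψE : ∀ u ∈ vectorSpan ℝ (proj B (k + 1) '' E), ψ u = 0 :=
    fun u hu => IsFace.apply_vectorSpan hψ hu
  obtain ⟨k', u, hk', huF, hu, rfl⟩ := hβP
  obtain rfl : k' = k + 1 := by omega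
  obtain ⟨k', w, hk', hwE, hw, rfl⟩ := hβF
  obtain rfl : k' = k := by omega
  have hu' : u = fun i => B (Fin.castLE hk i) := by
    ext1 i
    rw [← hu i (Fin.castLE hk i) rfl, proj_eq_self (hle (huF i))]
  have hwB : ∀ i, w i = B (Fin.castLE hk.le i) + B.repr (w i) ⟨k', hk⟩ • B ⟨k', hk⟩ := by
    intro i
    conv_lhs => rw [eq_proj_add hk (hle (hsub (hwE i))), hw i (Fin.castLE hk.le i) rfl]
  -- decompose `v`
  obtain ⟨y, hy, b, rfl⟩ : ∃ y ∈ Submodule.span ℝ (range w), ∃ b : ℝ, v = y + b • B ⟨k', hk⟩ := by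
    refine ⟨∑ i, B.repr v (Fin.castLE hk.le i) • w i, Submodule.sum_mem _ fun i _ =>
      Submodule.smul_mem _ _ (Submodule.subset_span (mem_range_self i)), ?_⟩
    refine ⟨B.repr (v - ∑ i, B.repr v (Fin.castLE hk.le i) • w i) ⟨k', hk⟩, ?_⟩
    have hmem : v - ∑ i, B.repr v (Fin.castLE hk.le i) • w i ∈ frameSpan B (k' + 1) :=
      Submodule.sub_mem _ (hle hv) (Submodule.sum_mem _ fun i _ =>
        Submodule.smul_mem _ _ (hle (hsub (hwE i))))
    have hz : proj B k' (v - ∑ i, B.repr v (Fin.castLE hk.le i) • w i) = 0 := by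
      rw [map_sub, map_sum, sub_eq_zero]
      simp only [map_smul, hw _ (Fin.castLE hk.le _) rfl]
      apply B.ext_elem
      intro j
      rw [repr_proj, map_sum, Finset.sum_apply']
      simp only [map_smul, Finsupp.smul_apply, Basis.repr_self, Finsupp.single_apply, smul_eq_mul]
      split_ifs with hj
      · rw [Finset.sum_eq_single (⟨j, hj⟩ : Fin k')]
        · simp
        · intro i _ hi
          rw [if_neg, mul_zero]
          intro h
          exact hi (Fin.ext (by simpa using congrArg Fin.val h))
        · simp
      · symm
        refine Finset.sum_eq_zero fun i _ => ?_
        rw [if_neg, mul_zero]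
        intro h
        exact hj (h ▸ i.2)
    have := eq_proj_add hk hmem
    rw [hz, zero_add] at this
    rw [← this]
    abel
  have hyE : y ∈ vectorSpan ℝ (proj B (k' + 1) '' E) :=
    Submodule.span_le.2 (by rintro _ ⟨i, rfl⟩; exact hwE i) hy
  have hb : 0 < b := by
    rw [map_add, mul_add, ιMulti_mul_ι_eq_zero w hy, zero_add, map_smul, mul_smul_comm,
      ιMulti_mul_ι_congr w _ _ (fun i => ⟨_, hwB i⟩), hu', smul_smul] at hrβ
    have h1 := ιMulti_castSucc_mul (fun i : Fin (k' + 1) => B (Fin.castLE hk i))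
    have h2 : ExteriorAlgebra.ιMulti ℝ (k' + 1) (fun i => B (Fin.castLE hk i)) =
        (r * b) • ExteriorAlgebra.ιMulti ℝ (k' + 1) (fun i => B (Fin.castLE hk i)) := by
      conv_rhs => rw [← h1]
      exact hrβ
    have h3 : (1 - r * b) • ExteriorAlgebra.ιMulti ℝ (k' + 1) (fun i => B (Fin.castLE hk i)) = 0 := by
      rw [sub_smul, one_smul, ← h2, sub_self]
    have h4 := (smul_eq_zero.1 h3).resolve_right (ιMulti_basis_ne_zero B hk)
    by_contra hneg
    have := mul_nonpos_of_nonneg_of_nonpos hr.le (not_lt.1 hneg)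
    linarith
  have hψB : 0 < s * ψ (B ⟨k', hk⟩) := by
    rw [map_add, hψE y hyE, zero_add, map_smul, smul_eq_mul] at hpos
    refine pos_of_mul_pos_right (a := b) ?_ hb.le
    calc 0 < _ := hpos
      _ = _ := by ring
  -- the functional
  set θ : Dual ℝ (Fin n → ℝ) := ψ ∘ₗ proj B (k' + 1) with hθ
  have hθB : θ (B ⟨k', hk⟩) = ψ (B ⟨k', hk⟩) := by
    rw [hθ, LinearMap.comp_apply, proj_basis, if_pos (Nat.lt_succ_self k')]
  have hFpoly : IsPolytope F := hF.isPolytope hP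
  have hface : IsFace F (argmax F θ) := hFpoly.isFace_argmax hF.1 θ
  have hEsub : E ⊆ argmax F θ := by
    intro x hx
    have : proj B (k' + 1) x ∈ proj B (k' + 1) '' E := mem_image_of_mem _ hx
    rw [hψ] at this
    exact ⟨hE.subset hx, fun z hz => this.2 _ (mem_image_of_mem _ hz)⟩
  have hd : dim (argmax F θ) ≤ dim E := by
    by_contra hcon
    have hlt : k' + 1 ≤ dim (argmax F θ) := by omega
    obtain ⟨x, hx, hx'⟩ := (hB _ (hF.trans hP hface)).surjOn
      (show B ⟨k', hk⟩ ∈ (frameSpan B (dim (argmax F θ)) : Set (Fin n → ℝ)) from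
        Submodule.subset_span ⟨⟨k', hk⟩, hlt, rfl⟩)
    have h0 : θ x = 0 := IsFace.apply_vectorSpan rfl hx
    have h1 : θ x = ψ (B ⟨k', hk⟩) := by
      rw [hθ, LinearMap.comp_apply, ← proj_proj B hlt, hx', proj_basis,
        if_pos (Nat.lt_succ_self k')]
    rw [← h1, h0, mul_zero] at hψB
    exact lt_irrefl _ hψB
  refine ⟨θ, hθB ▸ hψB, fun i hi => ?_, ?_⟩
  · rw [hθ, LinearMap.comp_apply, proj_basis, if_neg, map_zero]
    have : k' < (i : ℕ) := hi
    omega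
  · exact (hface.of_subset hE hEsub).eq_of_dim_le hd

theorem exists_frame_of_isCompl {W W' : Submodule ℝ (Fin n → ℝ)} (h : IsCompl W W') {k : ℕ}
    (hk : finrank ℝ W = k) :
    ∃ b : Frame n, frameSpan b k = W ∧ ∀ i : Fin n, k ≤ i → b i ∈ W' := by
  have hsum : k + finrank ℝ W' = n := by
    rw [← hk, Submodule.finrank_add_eq_of_isCompl h, finrank_fin_fun]
  let bW := finBasisOfFinrankEq ℝ W hk
  let bW' := finBasis ℝ W'
  let b : Frame n := ((bW.prod bW').map (Submodule.prodEquivOfIsCompl W W' h)).reindex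
    (finSumFinEquiv.trans (finCongr hsum))
  have hb1 : ∀ i : Fin n, (i : ℕ) < k → b i ∈ W := by
    intro i hi
    have : (finSumFinEquiv.trans (finCongr hsum)).symm i = Sum.inl ⟨i, hi⟩ := by
      rw [Equiv.symm_apply_eq]
      rfl
    simp only [b, Basis.reindex_apply, this, Basis.map_apply]
    simp
  have hb2 : ∀ i : Fin n, k ≤ i → b i ∈ W' := by
    intro i hi
    have : (finSumFinEquiv.trans (finCongr hsum)).symm i =
        Sum.inr ⟨i - k, by omega⟩ := by
      rw [Equiv.symm_apply_eq]
      ext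
      simp [hi]
    simp only [b, Basis.reindex_apply, this, Basis.map_apply]
    simp
  refine ⟨b, Submodule.eq_of_le_of_finrank_eq (Submodule.span_le.2 ?_) ?_, hb2⟩
  · rintro _ ⟨i, hi, rfl⟩
    exact hb1 i hi
  · rw [finrank_frameSpan b (by omega), hk]

theorem exists_frame (W : Submodule ℝ (Fin n → ℝ)) {k : ℕ} (hk : finrank ℝ W = k) :
    ∃ b : Frame n, frameSpan b k = W := by
  obtain ⟨W', h⟩ := Submodule.exists_isCompl W
  obtain ⟨b, hb, -⟩ := exists_frame_of_isCompl h hk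
  exact ⟨b, hb⟩

/-- The vectors of `B` from the `k`-th on are independent modulo `Lin E`. -/
def Transversal (B : Fin n → (Fin n → ℝ)) (k : ℕ) (E : Set (Fin n → ℝ)) : Prop :=
  ∀ c : Fin n → ℝ, (∀ j : Fin n, (j : ℕ) < k → c j = 0) → ∑ j, c j • B j ∈ vectorSpan ℝ E → c = 0

/-- The matrix with the first `k` rows of `e` and the remaining rows of `B`. -/
def rows (e B : Fin n → (Fin n → ℝ)) (k : ℕ) : Matrix (Fin n) (Fin n) ℝ :=
  fun i => if (i : ℕ) < k then e i else B i

theorem linearIndependent_rows_iff {M : Matrix (Fin n) (Fin n) ℝ} :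
    LinearIndependent ℝ M.row ↔ M.det ≠ 0 := by
  rw [Matrix.linearIndependent_rows_iff_isUnit, Matrix.isUnit_iff_isUnit_det, isUnit_iff_ne_zero]

theorem sum_smul_rows (e B : Fin n → (Fin n → ℝ)) (k : ℕ) (g : Fin n → ℝ) :
    ∑ i, g i • rows e B k i =
      ∑ i : Fin n, (if (i : ℕ) < k then g i else 0) • e i + ∑ i : Fin n, (if (i : ℕ) < k then 0 else g i) • B i := by
  rw [← Finset.sum_add_distrib]
  refine Finset.sum_congr rfl fun i _ => ?_
  unfold rows
  split_ifs <;> simp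

theorem sum_smul_mem_frameSpan (e : Frame n) (k : ℕ) (g : Fin n → ℝ) :
    ∑ i : Fin n, (if (i : ℕ) < k then g i else 0) • e i ∈ frameSpan e k := by
  refine Submodule.sum_mem _ fun i _ => ?_
  split_ifs with h
  · exact Submodule.smul_mem _ _ (Submodule.subset_span ⟨i, h, rfl⟩)
  · simp

theorem transversal_iff {e : Frame n} {k : ℕ} {E : Set (Fin n → ℝ)}
    (he : frameSpan e k = vectorSpan ℝ E) (B : Fin n → (Fin n → ℝ)) :
    Transversal B k E ↔ (rows e B k).det ≠ 0 := by
  rw [← linearIndependent_rows_iff, Fintype.linearIndependent_iff]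
  constructor
  · intro h g hg
    change ∑ i, g i • rows e B k i = 0 at hg
    rw [sum_smul_rows] at hg
    have hc := h (fun i => if (i : ℕ) < k then 0 else g i) (fun j hj => if_pos hj) (by
      rw [← neg_eq_of_add_eq_zero_right hg, ← he]
      exact Submodule.neg_mem _ (sum_smul_mem_frameSpan e k g))
    have hz : ∀ i : Fin n, (if (i : ℕ) < k then (0 : ℝ) else g i) = 0 := fun i => congrFun hc i
    simp only [hz, zero_smul, Finset.sum_const_zero, add_zero] at hg
    intro i
    have h1 := Fintype.linearIndependent_iff.1 e.linearIndependent _ hg i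
    have h2 := hz i
    split_ifs at h1 h2 <;> assumption
  · intro h c hc hmem
    rw [← he] at hmem
    set x := ∑ j, c j • B j with hx
    have h1 := h (fun i => if (i : ℕ) < k then -e.repr x i else c i) (by
      change ∑ i, _ • rows e B k i = 0
      rw [sum_smul_rows]
      have h2 : ∑ i : Fin n, (if (i : ℕ) < k then
          (if (i : ℕ) < k then -e.repr x i else c i) else 0) • e i = -x := by
        conv_rhs => rw [← e.sum_repr x, ← Finset.sum_neg_distrib]
        refine Finset.sum_congr rfl fun i _ => ?_
        split_ifs with h
        · rw [neg_smul]
        · rw [(mem_frameSpan e k x).1 hmem i (not_lt.1 h)]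
          simp
      have h3 : ∑ i : Fin n, (if (i : ℕ) < k then 0 else
          (if (i : ℕ) < k then -e.repr x i else c i)) • B i = x := by
        rw [hx]
        refine Finset.sum_congr rfl fun i _ => ?_
        split_ifs with h
        · rw [hc i h]
        · rfl
      rw [h2, h3, neg_add_cancel])
    ext i
    by_cases hi : (i : ℕ) < k
    · exact hc i hi
    · simpa [hi] using h1 i

theorem continuous_rows (e : Fin n → (Fin n → ℝ)) (k : ℕ) :
    Continuous fun B : Fin n → (Fin n → ℝ) => rows e B k := by
  refine continuous_pi fun i => ?_
  unfold rows
  split_ifs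
  · exact continuous_const
  · exact continuous_apply i

/-- The functional `x ↦ det (e₀, …, e_{k-1}, x, B_{k+1}, …)`. -/
noncomputable def detFunctional (e B : Fin n → (Fin n → ℝ)) (k : Fin n) : Dual ℝ (Fin n → ℝ) :=
  (Matrix.detRowAlternating (R := ℝ) (n := Fin n)).toMultilinearMap.toLinearMap (rows e B k) k

theorem detFunctional_apply (e B : Fin n → (Fin n → ℝ)) (k : Fin n) (x : Fin n → ℝ) :
    detFunctional e B k x = ((rows e B k).updateRow k x).det := rfl

theorem detFunctional_self (e B : Fin n → (Fin n → ℝ)) (k : Fin n) :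
    detFunctional e B k (B k) = (rows e B k).det := by
  rw [detFunctional_apply]
  congr 1
  have : B k = rows e B k k := by simp [rows]
  rw [this]
  exact Matrix.updateRow_eq_self _ _

theorem detFunctional_row (e B : Fin n → (Fin n → ℝ)) (k i : Fin n) (h : i ≠ k) :
    detFunctional e B k (rows e B k i) = 0 := by
  rw [detFunctional_apply]
  refine Matrix.det_zero_of_row_eq h ?_
  ext j
  simp [Matrix.updateRow_apply, h]

theorem detFunctional_of_lt (e B : Fin n → (Fin n → ℝ)) (k i : Fin n) (h : k < i) :
    detFunctional e B k (B i) = 0 := by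
  have := detFunctional_row e B k i h.ne'
  rwa [rows, if_neg (not_lt.2 (Fin.le_def.1 h.le))] at this

theorem detFunctional_of_gt (e B : Fin n → (Fin n → ℝ)) (k i : Fin n) (h : i < k) :
    detFunctional e B k (e i) = 0 := by
  have := detFunctional_row e B k i h.ne
  rwa [rows, if_pos (Fin.lt_def.1 h)] at this

theorem continuous_detFunctional (e : Fin n → (Fin n → ℝ)) (k : Fin n)
    {f : (Fin n → (Fin n → ℝ)) → (Fin n → ℝ)} (hf : Continuous f) :
    Continuous fun B : Fin n → (Fin n → ℝ) => detFunctional e B k (f B) := by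
  simp only [detFunctional_apply]
  exact ((continuous_rows e k).matrix_updateRow k hf).matrix_det

theorem eventually_side {s : ℝ} {B₀ : Fin n → (Fin n → ℝ)} {k : Fin n} {F E : Set (Fin n → ℝ)}
    (hF : IsPolytope F) (hE : IsFace F E) (hd : dim E = k) (htr : Transversal B₀ k E)
    (h : Side s B₀ k F E) : ∀ᶠ B in 𝓝 B₀, Side s B k F E := by
  have hconv := hE.convex hF
  obtain ⟨t, rfl⟩ := hF
  obtain ⟨θ, hpos, hzero, hθ⟩ := h
  obtain ⟨g, hg⟩ := hE.1
  have hg' : g ∈ argmax (convexHull ℝ (t : Set (Fin n → ℝ))) θ := hθ ▸ hg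
  obtain ⟨e, he⟩ := exists_frame (vectorSpan ℝ E) hd
  have hdet := (transversal_iff he B₀).1 htr
  set r : ℝ := θ (B₀ k) / (rows e B₀ k).det with hr
  have hθr : θ = r • detFunctional e B₀ k := by
    have hind := linearIndependent_rows_iff.2 hdet
    let b : Frame n := Basis.mk hind (hind.span_eq_top_of_card_eq_finrank' (by simp)).ge
    refine b.ext fun i => ?_
    have hb : b i = rows e B₀ k i := Basis.mk_apply _ _ i
    rw [hb, LinearMap.smul_apply, smul_eq_mul]
    rcases lt_trichotomy i k with h | h | h
    · rw [detFunctional_row e B₀ k i h.ne, mul_zero, rows, if_pos (Fin.lt_def.1 h)]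
      refine IsFace.apply_vectorSpan hθ ?_
      rw [← he]
      exact Submodule.subset_span ⟨i, h, rfl⟩
    · subst h
      have : rows e B₀ i i = B₀ i := by simp [rows]
      rw [this, detFunctional_self, hr, div_mul_cancel₀ _ hdet]
    · rw [detFunctional_row e B₀ k i h.ne', mul_zero, rows,
        if_neg (not_lt.2 (Fin.le_def.1 h.le)), hzero i h]
  have hev1 : ∀ᶠ B in 𝓝 B₀, 0 < s * (r • detFunctional e B k) (B k) := by
    have hc : Continuous fun B : Fin n → (Fin n → ℝ) => s * (r • detFunctional e B k) (B k) :=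
      continuous_const.mul (continuous_const.mul
        (continuous_detFunctional e k (continuous_apply k)))
    refine hc.continuousAt.eventually (lt_mem_nhds ?_)
    change 0 < s * (r • detFunctional e B₀ k) (B₀ k)
    rwa [← hθr]
  have hev2 : ∀ᶠ B in 𝓝 B₀, ∀ w ∈ t, w ∉ E →
      (r • detFunctional e B k) w < (r • detFunctional e B k) g := by
    rw [Finset.eventually_all]
    intro w hw
    by_cases hwE : w ∈ E
    · exact Eventually.of_forall fun _ h => absurd hwE h
    · have hc : ∀ x : Fin n → ℝ, Continuous fun B : Fin n → (Fin n → ℝ) =>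
          (r • detFunctional e B k) x := fun x =>
        continuous_const.mul (continuous_detFunctional e k continuous_const)
      have hlt : (r • detFunctional e B₀ k) w < (r • detFunctional e B₀ k) g := by
        rw [← hθr]
        have hw' := subset_convexHull ℝ _ hw
        refine lt_of_le_of_ne (hg'.2 w hw') fun h => hwE ?_
        rw [hθ, argmax_eq hg']
        exact ⟨hw', h⟩
      filter_upwards [(hc w).continuousAt.eventually_lt (hc g).continuousAt hlt] with B hB _
        using hB
  filter_upwards [hev1, hev2] with B h1 h2
  refine ⟨r • detFunctional e B k, h1, fun i hi => ?_, ?_⟩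
  · rw [LinearMap.smul_apply, detFunctional_of_lt e B k i hi, smul_zero]
  · refine argmax_convexHull hconv hE.subset ⟨g, hg⟩ (fun x hx => ?_) h2
    have hker : frameSpan e k ≤ LinearMap.ker (detFunctional e B k) := by
      refine Submodule.span_le.2 ?_
      rintro _ ⟨i, hi, rfl⟩
      exact detFunctional_of_gt e B k i hi
    have h3 : detFunctional e B k (x - g) = 0 := hker (he ▸ vsub_mem hx hg)
    rw [map_sub, sub_eq_zero] at h3
    rw [LinearMap.smul_apply, LinearMap.smul_apply, h3]

theorem AdmissibleAt.of_transversal {B : Frame n} {F : Set (Fin n → ℝ)}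
    (h : Transversal B (dim F) F) : AdmissibleAt B F := by
  have hinj : InjOn (proj B (dim F)) (vectorSpan ℝ F : Set (Fin n → ℝ)) := by
    intro x hx y hy hxy
    have h0 : proj B (dim F) (x - y) = 0 := by rw [map_sub, hxy, sub_self]
    have hrepr : ∀ i : Fin n, (i : ℕ) < dim F → B.repr (x - y) i = 0 := by
      intro i hi
      have := repr_proj B (dim F) (x - y) i
      rwa [h0, if_pos hi, map_zero, Finsupp.zero_apply, eq_comm] at this
    have h1 := h (B.repr (x - y)) hrepr (by
      rw [B.sum_repr]
      exact Submodule.sub_mem _ hx hy)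
    have h2 : x - y = 0 := by
      rw [← B.sum_repr (x - y), h1]
      simp
    exact sub_eq_zero.1 h2
  have hle : (vectorSpan ℝ F).map (proj B (dim F)) ≤ frameSpan B (dim F) := by
    rintro _ ⟨x, -, rfl⟩
    exact proj_mem_frameSpan B _ x
  have heq : (vectorSpan ℝ F).map (proj B (dim F)) = frameSpan B (dim F) := by
    refine Submodule.eq_of_le_of_finrank_eq hle ?_
    have hn : dim F ≤ n := (Submodule.finrank_le _).trans (finrank_fin_fun ℝ).le
    rw [finrank_frameSpan B hn]
    have hinj' : Function.Injective ((proj B (dim F)).domRestrict (vectorSpan ℝ F)) :=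
      fun x y hxy => Subtype.ext (hinj x.2 y.2 hxy)
    have := LinearMap.finrank_range_of_inj hinj'
    rwa [LinearMap.range_domRestrict] at this
  refine ⟨fun x _ => proj_mem_frameSpan B _ x, hinj, ?_⟩
  intro y hy
  rw [← heq] at hy
  exact hy

theorem AdmissibleAt.transversal {B : Frame n} {F : Set (Fin n → ℝ)} (h : AdmissibleAt B F) :
    Transversal B (dim F) F := by
  intro c hc hmem
  have h0 : proj B (dim F) (∑ j, c j • B j) = 0 := by
    rw [map_sum]
    refine Finset.sum_eq_zero fun j _ => ?_
    rw [map_smul, proj_basis]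
    split_ifs with hj
    · rw [hc j hj, zero_smul]
    · rw [smul_zero]
  have h1 := h.injOn hmem (Submodule.zero_mem _) (by rw [h0, map_zero])
  exact funext (Fintype.linearIndependent_iff.1 B.linearIndependent c h1)

/-- `det (rows e B k)` as a polynomial in the entries of `B`. -/
noncomputable def detPoly (e : Fin n → (Fin n → ℝ)) (k : ℕ) : MvPolynomial (Fin n × Fin n) ℝ :=
  Matrix.det (Matrix.of fun i j : Fin n => if (i : ℕ) < k then MvPolynomial.C (e i j)
    else MvPolynomial.X (i, j))

theorem eval_detPoly (e : Fin n → (Fin n → ℝ)) (k : ℕ) (x : Fin n × Fin n → ℝ) :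
    MvPolynomial.eval x (detPoly e k) = (rows e (fun i j => x (i, j)) k).det := by
  rw [detPoly, RingHom.map_det]
  congr 1
  ext i j
  rw [RingHom.mapMatrix_apply, Matrix.map_apply, Matrix.of_apply, rows]
  split_ifs <;> simp

theorem detPoly_ne_zero (e : Frame n) (k : ℕ) : detPoly e k ≠ 0 := by
  intro h
  have h1 := eval_detPoly e k fun ij => e ij.1 ij.2
  have h2 : (rows e (fun i j => e i j) k) = fun i j => e i j := by
    ext i j
    rw [rows]
    split_ifs <;> rfl
  rw [h, map_zero] at h1
  refine linearIndependent_rows_iff.1 ?_ h1.symm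
  rw [h2]
  exact e.linearIndependent

/-- The admissible frames are dense among the `n`-tuples of vectors. -/
theorem exists_admissible {P : Set (Fin n → ℝ)} (hP : IsPolytope P)
    {U : Set (Fin n → (Fin n → ℝ))} {B₀ : Fin n → (Fin n → ℝ)} (hU : U ∈ 𝓝 B₀) :
    ∃ B : Frame n, ⇑B ∈ U ∧ IsAdmissible B P := by
  have hex : ∀ F : Set (Fin n → ℝ), ∃ e : Frame n, frameSpan e (dim F) = vectorSpan ℝ F :=
    fun F => exists_frame _ rfl
  choose e he using hex
  let p : MvPolynomial (Fin n × Fin n) ℝ :=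
    detPoly (Pi.basisFun ℝ (Fin n)) 0 * ∏ F ∈ hP.finite_faces.toFinset, detPoly (e F) (dim F)
  have hp : p ≠ 0 := mul_ne_zero (detPoly_ne_zero _ _)
    (Finset.prod_ne_zero_iff.2 fun F _ => detPoly_ne_zero _ _)
  obtain ⟨ε, hε, hball⟩ := Metric.mem_nhds_iff.1 hU
  let S : Fin n × Fin n → Set ℝ := fun ij => Metric.ball (B₀ ij.1 ij.2) ε
  have hS : ∀ ij, (S ij).Infinite := fun ij => by
    simp only [S, Real.ball_eq_Ioo]
    exact Ioo_infinite (by linarith)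
  obtain ⟨x, hx, hxp⟩ : ∃ x ∈ Set.pi univ S, MvPolynomial.eval x p ≠ 0 := by
    by_contra hcon
    push Not at hcon
    exact hp (MvPolynomial.funext_set S hS (by simpa using hcon))
  simp only [p, map_mul, map_prod, eval_detPoly] at hxp
  set B : Fin n → (Fin n → ℝ) := fun i j => x (i, j) with hB
  have hBU : B ∈ U := by
    refine hball ?_
    rw [Metric.mem_ball, dist_pi_lt_iff hε]
    intro i
    rw [dist_pi_lt_iff hε]
    exact fun j => hx (i, j) (mem_univ _)
  have hind : LinearIndependent ℝ B := by
    have h1 := linearIndependent_rows_iff.2 (left_ne_zero_of_mul hxp)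
    have h2 : rows (⇑(Pi.basisFun ℝ (Fin n))) B 0 = B := by
      ext i j
      simp [rows]
    rwa [h2] at h1
  let b : Frame n := Basis.mk hind (hind.span_eq_top_of_card_eq_finrank' (by simp)).ge
  have hb : ⇑b = B := Basis.coe_mk _ _
  refine ⟨b, hb ▸ hBU, fun F hF => AdmissibleAt.of_transversal ?_⟩
  rw [transversal_iff (he F), hb]
  exact Finset.prod_ne_zero_iff.1 (right_ne_zero_of_mul hxp) F (by simpa using hF)

/-- A cyclic string of faces of `P`, given by linear conditions that are open in `B`. -/
def OpenLoop (B : Fin n → (Fin n → ℝ)) (P : Set (Fin n → ℝ)) (k : Fin n) : Prop :=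
  ∃ (m : ℕ) (F : Fin m → Set (Fin n → ℝ)), (∀ i, IsFace P (F i) ∧ (k : ℕ) < dim (F i)) ∧
    (∀ i j : Fin m, (j : ℕ) = (i : ℕ) + 1 → ∃ E, IsFace (F i) E ∧ IsFace (F j) E ∧ dim E = k ∧
      Transversal B k E ∧ Side 1 B k (F i) E ∧ Side (-1) B k (F j) E) ∧
    ∃ i j, i ≠ j ∧ F i = F j

theorem OpenLoop.admitsLoop {B₀ : Fin n → (Fin n → ℝ)} {P : Set (Fin n → ℝ)} {k : Fin n}
    (hP : IsPolytope P) (h : OpenLoop B₀ P k) : AdmitsLoop P k := by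
  obtain ⟨m, F, hF, hE, hrep⟩ := h
  have hev : ∀ᶠ B in 𝓝 B₀, ∀ i j : Fin m, (j : ℕ) = (i : ℕ) + 1 → ∃ E, IsFace (F i) E ∧
      IsFace (F j) E ∧ dim E = k ∧ Side 1 B k (F i) E ∧ Side (-1) B k (F j) E := by
    refine eventually_all.2 fun i => eventually_all.2 fun j => ?_
    by_cases hij : (j : ℕ) = (i : ℕ) + 1
    · obtain ⟨E, h1, h2, h3, h4, h5, h6⟩ := hE i j hij
      filter_upwards [eventually_side ((hF i).1.isPolytope hP) h1 h3 h4 h5,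
        eventually_side ((hF j).1.isPolytope hP) h2 h3 h4 h6] with B h7 h8 _
      exact ⟨E, h1, h2, h3, h7, h8⟩
    · exact Eventually.of_forall fun _ h => absurd h hij
  obtain ⟨B, hB, hadm⟩ := exists_admissible hP hev
  refine ⟨B, hadm, m, F, ⟨hF, fun i j hij => ?_⟩, hrep⟩
  obtain ⟨E, h1, h2, h3, h4, h5⟩ := hB i j hij
  have hEadm : AdmissibleAt B E := hadm E ((hF i).1.trans hP h1)
  refine ⟨E, ?_, ?_⟩
  · rw [kTarget_eq]
    exact mem_kSide_of_side k.2 h1 h3 (hF i).2 hEadm h4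
  · rw [kSource_eq]
    exact mem_kSide_of_side k.2 h2 h3 (hF j).2 hEadm h5

theorem HasLoop.openLoop {B : Frame n} {P : Set (Fin n → ℝ)} {k : ℕ} (hk : k < n)
    (hP : IsPolytope P) (hB : IsAdmissible B P) (h : HasLoop B P k) : OpenLoop B P ⟨k, hk⟩ := by
  obtain ⟨m, F, ⟨hF, hE⟩, hrep⟩ := h
  refine ⟨m, F, hF, fun i j hij => ?_, hrep⟩
  obtain ⟨E, h1, h2⟩ := hE i j hij
  rw [kTarget_eq] at h1
  rw [kSource_eq] at h2
  obtain ⟨h3, h4, -⟩ := h1.1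
  refine ⟨E, h3, h2.1.1, h4, ?_, side_of_mem_kSide hk hP hB (hF i).1 h1,
    side_of_mem_kSide hk hP hB (hF j).1 h2⟩
  have := (show AdmissibleAt B E from hB E ((hF i).1.trans hP h3)).transversal
  rwa [h4] at this

/-- Affinely independent points can be given arbitrary values, up to a common constant, by a
linear functional. -/
theorem exists_dual_of_affineIndependent {ι : Type*} {p : ι → (Fin n → ℝ)}
    (hp : AffineIndependent ℝ p) (c : ι → ℝ) :
    ∃ (θ : Dual ℝ (Fin n → ℝ)) (a : ℝ), ∀ i, θ (p i) = c i + a := by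
  rcases isEmpty_or_nonempty ι with h | ⟨⟨i₀⟩⟩
  · exact ⟨0, 0, fun i => (h.false i).elim⟩
  have hli := (affineIndependent_iff_linearIndependent_vsub ℝ p i₀).1 hp
  let b := Basis.span hli
  obtain ⟨θ, hθ⟩ := LinearMap.exists_extend (b.constr ℝ fun i => c i - c i₀)
  refine ⟨θ, θ (p i₀) - c i₀, fun i => ?_⟩
  by_cases hi : i = i₀
  · subst hi
    ring
  · have h1 := LinearMap.congr_fun hθ (b ⟨i, hi⟩)
    rw [LinearMap.comp_apply, Basis.constr_basis, Submodule.subtype_apply, Basis.span_apply] at h1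
    simp only [vsub_eq_sub, map_sub] at h1
    linarith

/-- The face of a simplex spanned by the vertices with index in `T`. -/
def subsimplex {m : ℕ} (p : Fin m → (Fin n → ℝ)) (T : Finset (Fin m)) : Set (Fin n → ℝ) :=
  convexHull ℝ (p '' (T : Set (Fin m)))

theorem subsimplex_eq_argmax {m : ℕ} {p : Fin m → (Fin n → ℝ)} {T U : Finset (Fin m)}
    (hT : T.Nonempty) (hTU : T ⊆ U) {θ : Dual ℝ (Fin n → ℝ)} {M : ℝ}
    (h1 : ∀ i ∈ T, θ (p i) = M) (h2 : ∀ i ∈ U, i ∉ T → θ (p i) < M) :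
    subsimplex p T = argmax (subsimplex p U) θ := by
  refine argmax_convexHull (convex_convexHull ℝ _) (convexHull_mono (image_mono hTU))
    (hT.to_set.image p).convexHull (M := M) ?_ ?_
  · intro x hx
    refine convexHull_min (t := {x | θ x = M}) ?_ (convex_hyperplane (LinearMap.isLinear θ) M) hx
    rintro _ ⟨i, hi, rfl⟩
    exact h1 i hi
  · rintro _ ⟨i, hi, rfl⟩ hn
    exact h2 i hi fun h => hn (subset_convexHull ℝ _ (mem_image_of_mem p h))

theorem isFace_subsimplex {m : ℕ} {p : Fin m → (Fin n → ℝ)} (hp : AffineIndependent ℝ p)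
    {T U : Finset (Fin m)} (hT : T.Nonempty) (hTU : T ⊆ U) :
    IsFace (subsimplex p U) (subsimplex p T) := by
  obtain ⟨θ, a, hθ⟩ := exists_dual_of_affineIndependent hp fun i => if i ∈ T then 1 else 0
  refine isFace_iff.2 ⟨(hT.to_set.image p).convexHull, θ,
    subsimplex_eq_argmax hT hTU (M := 1 + a) (fun i hi => ?_) fun i _ hi => ?_⟩
  · rw [hθ, if_pos hi]
  · rw [hθ, if_neg hi]
    linarith

theorem dim_subsimplex {m : ℕ} {p : Fin m → (Fin n → ℝ)} (hp : AffineIndependent ℝ p)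
    {T : Finset (Fin m)} {d : ℕ} (hT : T.card = d + 1) : dim (subsimplex p T) = d := by
  classical
  rw [dim, subsimplex, vectorSpan_convexHull, ← Finset.coe_image]
  exact hp.finrank_vectorSpan_image_finset hT

theorem subsimplex_univ {m : ℕ} (p : Fin m → (Fin n → ℝ)) :
    subsimplex p Finset.univ = convexHull ℝ (range p) := by
  rw [subsimplex, Finset.coe_univ, image_univ]

theorem transversal_edge {m : ℕ} {p : Fin m → (Fin n → ℝ)} {B : Fin n → (Fin n → ℝ)}
    (hB : ∀ c : Fin n → ℝ, (∀ j : Fin n, (j : ℕ) < 1 → c j = 0) → ∑ j, c j • B j = 0 → c = 0)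
    {ξ : Dual ℝ (Fin n → ℝ)} (hξ : ∀ j : Fin n, 1 ≤ (j : ℕ) → ξ (B j) = 0) {i j : Fin m}
    (hij : ξ (p i) ≠ ξ (p j)) : Transversal B 1 (subsimplex p {i, j}) := by
  intro c hc hmem
  rw [subsimplex, vectorSpan_convexHull, Finset.coe_pair, image_pair, mem_vectorSpan_pair] at hmem
  obtain ⟨r, hr⟩ := hmem
  have h0 : ξ (∑ j, c j • B j) = 0 := by
    rw [map_sum]
    refine Finset.sum_eq_zero fun l _ => ?_
    rcases Nat.lt_or_ge l 1 with h | h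
    · rw [hc l h, zero_smul, map_zero]
    · rw [map_smul, hξ l h, smul_zero]
  rw [← hr, map_smul, vsub_eq_sub, map_sub, smul_eq_mul] at h0
  have hr0 : r = 0 := (mul_eq_zero.1 h0).resolve_right (sub_ne_zero.2 hij)
  rw [hr0, zero_smul] at hr
  exact hB c hc hr.symm

/-- A tuple whose vectors from the first one on are adapted to the map `(ξ, η)`. -/
theorem exists_tuple {ξ η : Dual ℝ (Fin n → ℝ)} {u w : Fin n → ℝ} (hn : 1 < n)
    (hu : ξ u = 0) (hu' : η u ≠ 0) (hw : ξ w ≠ 0) (hw' : η w = 0) :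
    ∃ B : Fin n → (Fin n → ℝ), B ⟨1, hn⟩ = u ∧
      (∀ j : Fin n, ⟨1, hn⟩ < j → ξ (B j) = 0 ∧ η (B j) = 0) ∧
      ∀ c : Fin n → ℝ, (∀ j : Fin n, (j : ℕ) < 1 → c j = 0) → ∑ j, c j • B j = 0 → c = 0 := by
  have hsurj : LinearMap.range (ξ.prod η) = ⊤ := by
    rw [LinearMap.range_eq_top]
    rintro ⟨a, b⟩
    refine ⟨(a / ξ w) • w + (b / η u) • u, ?_⟩
    simp [hu, hw', hw, hu']
  obtain ⟨W, hW⟩ := Submodule.exists_isCompl (LinearMap.ker (ξ.prod η))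
  have hfin : finrank ℝ W = 2 := by
    have h1 := Submodule.finrank_add_eq_of_isCompl hW
    have h2 := LinearMap.finrank_range_add_finrank_ker (ξ.prod η)
    rw [hsurj, finrank_top, finrank_prod, finrank_self] at h2
    omega
  obtain ⟨b, -, hb⟩ := exists_frame_of_isCompl hW.symm hfin
  have hb' : ∀ j : Fin n, ⟨1, hn⟩ < j → ξ (b j) = 0 ∧ η (b j) = 0 := by
    intro j hj
    have := hb j hj
    rwa [LinearMap.mem_ker, LinearMap.prod_apply, Function.prod_apply, Prod.mk_eq_zero] at this
  refine ⟨Function.update b ⟨1, hn⟩ u, Function.update_self .., fun j hj => ?_, fun c hc h => ?_⟩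
  · rw [Function.update_of_ne hj.ne']
    exact hb' j hj
  · have h1 : c ⟨1, hn⟩ = 0 := by
      have h2 := congrArg η h
      rw [map_sum, map_zero, Finset.sum_eq_single ⟨1, hn⟩] at h2
      · rw [Function.update_self, map_smul, smul_eq_mul] at h2
        exact (mul_eq_zero.1 h2).resolve_right hu'
      · intro j _ hj
        rw [Function.update_of_ne hj, map_smul]
        rcases lt_or_gt_of_ne hj with h | h
        · rw [hc j h, zero_smul]
        · rw [(hb' j h).2, smul_zero]
      · simp
    refine funext (Fintype.linearIndependent_iff.1 b.linearIndependent c ?_)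
    rw [← h]
    refine Finset.sum_congr rfl fun j _ => ?_
    by_cases hj : j = ⟨1, hn⟩
    · rw [hj, h1, zero_smul, zero_smul]
    · rw [Function.update_of_ne hj]

/-- A polytope with a `5`-dimensional simplex as a face admits a frame inducing a loop. -/
theorem admitsLoop_of_simplex {P : Set (Fin n → ℝ)} (hP : IsPolytope P)
    {p : Fin 6 → (Fin n → ℝ)} (hp : AffineIndependent ℝ p)
    (hS : IsFace P (subsimplex p Finset.univ)) : ∃ k, AdmitsLoop P k := by
  have hn : 1 < n := by
    have h1 : dim (subsimplex p Finset.univ) = 5 := dim_subsimplex hp (by simp)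
    have h2 : dim (subsimplex p Finset.univ) ≤ n := (Submodule.finrank_le _).trans
      (finrank_fin_fun ℝ).le
    omega
  let x : Fin 6 → ℤ := ![2, 1, 2, -1, -2, -2]
  let y : Fin 6 → ℤ := ![1, 0, -1, 0, 1, -1]
  obtain ⟨ξ, a, hξ⟩ := exists_dual_of_affineIndependent hp fun i => (x i : ℝ)
  obtain ⟨η, a', hη⟩ := exists_dual_of_affineIndependent hp fun i => (y i : ℝ)
  obtain ⟨B, hB1, hB2, hB⟩ := exists_tuple (ξ := ξ) (η := η) (u := p 0 - p 2) (w := p 1 - p 3) hn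
    (by simp [hξ, x]) (by simp [hη, y]) (by simp [hξ, x]) (by simp [hη, y])
  have hside : ∀ (s α β M : ℤ) (T U : Finset (Fin 6)), 0 < s * β → T.Nonempty → T ⊆ U →
      (∀ i ∈ T, α * x i + β * y i = M) → (∀ i ∈ U, i ∉ T → α * x i + β * y i < M) →
      Side s B ⟨1, hn⟩ (subsimplex p U) (subsimplex p T) := by
    intro s α β M T U hs hT hTU h1 h2
    refine ⟨(α : ℝ) • ξ + (β : ℝ) • η, ?_, fun i hi => ?_,
      subsimplex_eq_argmax hT hTU (M := M + α * a + β * a') (fun i hi => ?_) fun i hi hiT => ?_⟩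
    · have hs' : (0 : ℝ) < s * β := by exact_mod_cast hs
      simp only [hB1, LinearMap.add_apply, LinearMap.smul_apply, map_sub, hξ, hη, smul_eq_mul]
      simp only [x, y, Matrix.cons_val]
      push_cast
      linarith
    · simp [hB2 i hi]
    · have h1' : (α * x i + β * y i : ℝ) = M := by exact_mod_cast h1 i hi
      simp only [LinearMap.add_apply, LinearMap.smul_apply, hξ, hη, smul_eq_mul, ← h1']
      ring
    · have h2' : (α * x i + β * y i : ℝ) < M := by exact_mod_cast h2 i hi hiT
      simp only [LinearMap.add_apply, LinearMap.smul_apply, hξ, hη, smul_eq_mul]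
      linarith
  have hξB : ∀ j : Fin n, 1 ≤ (j : ℕ) → ξ (B j) = 0 := by
    intro j hj
    rcases Nat.lt_or_ge 1 j with h | h
    · exact (hB2 j h).1
    · have : j = ⟨1, hn⟩ := Fin.ext (le_antisymm h hj)
      rw [this, hB1, map_sub, hξ, hξ]
      simp [x]
  -- the edge `i j` is in the target of `U` and in the source of `U'`
  have hstep : ∀ (α M : ℤ) (i j : Fin 6) (U U' : Finset (Fin 6)), x i ≠ x j →
      {i, j} ⊆ U → {i, j} ⊆ U' →
      (∀ l ∈ ({i, j} : Finset (Fin 6)), α * x l + 1 * y l = M) →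
      (∀ l ∈ U, l ∉ ({i, j} : Finset (Fin 6)) → α * x l + 1 * y l < M) →
      (∀ l ∈ ({i, j} : Finset (Fin 6)), -α * x l + -1 * y l = -M) →
      (∀ l ∈ U', l ∉ ({i, j} : Finset (Fin 6)) → -α * x l + -1 * y l < -M) →
      ∃ E, IsFace (subsimplex p U) E ∧ IsFace (subsimplex p U') E ∧ dim E = 1 ∧
        Transversal B 1 E ∧ Side 1 B ⟨1, hn⟩ (subsimplex p U) E ∧
        Side (-1) B ⟨1, hn⟩ (subsimplex p U') E := by
    intro α M i j U U' hx hU hU' h1 h2 h3 h4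
    have hij : i ≠ j := fun h => hx (congrArg x h)
    refine ⟨subsimplex p {i, j}, isFace_subsimplex hp (by simp) hU,
      isFace_subsimplex hp (by simp) hU', dim_subsimplex hp (Finset.card_pair hij),
      transversal_edge hB hξB (by simpa [hξ] using hx), ?_, ?_⟩
    · simpa using hside 1 α 1 M _ _ (by norm_num) (by simp) hU h1 h2
    · simpa using hside (-1) (-α) (-1) (-M) _ _ (by norm_num) (by simp) hU' h3 h4
  let U : Fin 5 → Finset (Fin 6) :=
    ![{0, 1, 3, 5}, {3, 4, 5}, {1, 2, 3, 4}, {0, 1, 2}, {0, 1, 3, 5}]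
  have hU : ∀ i, 2 < (U i).card := by decide
  refine ⟨_, OpenLoop.admitsLoop (k := ⟨1, hn⟩) (B₀ := B) hP ⟨5, fun i => subsimplex p (U i),
    fun i => ⟨hS.trans hP (isFace_subsimplex hp (Finset.card_pos.1 (by have := hU i; omega))
      (Finset.subset_univ _)), ?_⟩, fun i j hij => ?_, 0, 4, by decide, rfl⟩⟩
  · have := hU i
    change 1 < _
    rw [dim_subsimplex hp (d := (U i).card - 1) (by omega)]
    omega
  · have hj : j = i + 1 ∧ (i : ℕ) < 4 := by
      have := j.2
      refine ⟨Fin.ext ?_, by omega⟩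
      rw [hij, Fin.val_add_one_of_lt' (by omega)]
    obtain ⟨rfl, hi⟩ := hj
    fin_cases i
    · exact hstep (-1) 1 3 5 {0, 1, 3, 5} {3, 4, 5} (by decide) (by decide) (by decide)
        (by decide) (by decide) (by decide) (by decide)
    · exact hstep 1 (-1) 3 4 {3, 4, 5} {1, 2, 3, 4} (by decide) (by decide) (by decide)
        (by decide) (by decide) (by decide) (by decide)
    · exact hstep 1 1 1 2 {1, 2, 3, 4} {0, 1, 2} (by decide) (by decide) (by decide)
        (by decide) (by decide) (by decide) (by decide)
    · exact hstep (-1) (-1) 0 1 {0, 1, 2} {0, 1, 3, 5} (by decide) (by decide) (by decide)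
        (by decide) (by decide) (by decide) (by decide)
    · exact absurd hi (by decide)

/-- The hyperplane `{φ = c}` separates the point `v` of `t` from the other points of `t`. -/
structure IsApex (t : Set (Fin n → ℝ)) (v : Fin n → ℝ) (φ : Dual ℝ (Fin n → ℝ)) (c : ℝ) :
    Prop where
  mem : v ∈ t
  lt : φ v < c
  lt_apply : ∀ w ∈ t, w ≠ v → c < φ w

namespace IsApex

variable {t : Set (Fin n → ℝ)} {v : Fin n → ℝ} {φ : Dual ℝ (Fin n → ℝ)} {c : ℝ}

theorem mem_hull (h : IsApex t v φ c) : v ∈ convexHull ℝ t := subset_convexHull ℝ _ h.mem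

theorem inter (h : IsApex t v φ c) {L : Set (Fin n → ℝ)} (hv : v ∈ L) :
    IsApex (t ∩ L) v φ c :=
  ⟨⟨h.mem, hv⟩, h.lt, fun w hw => h.lt_apply w hw.1⟩

/-- The edge from the apex to another point of `t` meets the hyperplane. -/
theorem exists_section (h : IsApex t v φ c) {w : Fin n → ℝ} (hw : w ∈ t) (hne : w ≠ v) :
    ∃ q ∈ convexHull ℝ t ∩ {x | φ x = c}, ∃ r : ℝ, 0 < r ∧ w - v = r • (q - v) := by
  have h1 := h.lt
  have h2 := h.lt_apply w hw hne
  have h3 : 0 < φ w - φ v := by linarith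
  have h4 : 0 < (c - φ v) / (φ w - φ v) := div_pos (by linarith) h3
  refine ⟨v + ((c - φ v) / (φ w - φ v)) • (w - v), ⟨?_, ?_⟩, (φ w - φ v) / (c - φ v),
    div_pos h3 (by linarith), ?_⟩
  · refine (convex_convexHull ℝ t).add_smul_sub_mem h.mem_hull (subset_convexHull ℝ _ hw)
      ⟨h4.le, ?_⟩
    rw [div_le_one h3]
    linarith
  · simp only [mem_ofPred_eq, map_add, map_smul, map_sub, smul_eq_mul]
    rw [div_mul_cancel₀ _ h3.ne']
    ring
  · rw [add_sub_cancel_left, smul_smul, div_mul_div_cancel₀ (by linarith), div_self h3.ne',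
      one_smul]

theorem apply_le (h : IsApex t v φ c) {θ : Dual ℝ (Fin n → ℝ)}
    (hθ : ∀ q ∈ convexHull ℝ t ∩ {x | φ x = c}, θ q ≤ θ v) :
    v ∈ argmax (convexHull ℝ t) θ := by
  refine ⟨h.mem_hull, convexHull_le fun w hw => ?_⟩
  by_cases hne : w = v
  · rw [hne]
  obtain ⟨q, hq, r, hr, hqr⟩ := h.exists_section hw hne
  have h1 : θ w - θ v = r * (θ q - θ v) := by
    rw [← map_sub, ← map_sub, hqr, map_smul, smul_eq_mul]
  have h2 := mul_nonneg hr.le (sub_nonneg.2 (hθ q hq))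
  linarith

/-- A functional becomes maximal at the apex and at its maximal locus on the section after
addition of a multiple of `φ`. -/
theorem exists_lift (h : IsApex t v φ c) {ψ : Dual ℝ (Fin n → ℝ)}
    (hne : (argmax (convexHull ℝ t ∩ {x | φ x = c}) ψ).Nonempty) :
    ∃ a : ℝ, v ∈ argmax (convexHull ℝ t) (ψ + a • φ) ∧
      argmax (convexHull ℝ t) (ψ + a • φ) ∩ {x | φ x = c} =
        argmax (convexHull ℝ t ∩ {x | φ x = c}) ψ := by
  obtain ⟨g, hg⟩ := hne
  have hc : c - φ v ≠ 0 := by linarith [h.lt]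
  set a := (ψ v - ψ g) / (c - φ v) with ha
  have hag : ψ g + a * c = ψ v + a * φ v := by
    have : a * (c - φ v) = ψ v - ψ g := div_mul_cancel₀ _ hc
    linarith
  have hv : v ∈ argmax (convexHull ℝ t) (ψ + a • φ) := by
    refine h.apply_le fun q hq => ?_
    have h1 := hg.2 q hq
    have h2 : φ q = c := hq.2
    simp only [LinearMap.add_apply, LinearMap.smul_apply, smul_eq_mul, h2]
    linarith
  refine ⟨a, hv, ?_⟩
  rw [argmax_eq hv, argmax_eq hg]
  ext x
  constructor
  · rintro ⟨⟨hx, hx'⟩, hxc⟩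
    refine ⟨⟨hx, hxc⟩, ?_⟩
    rw [mem_ofPred_eq] at hxc
    simp only [LinearMap.add_apply, LinearMap.smul_apply, smul_eq_mul, hxc] at hx'
    linarith
  · rintro ⟨⟨hx, hxc⟩, hx'⟩
    refine ⟨⟨hx, ?_⟩, hxc⟩
    rw [mem_ofPred_eq] at hxc
    simp only [LinearMap.add_apply, LinearMap.smul_apply, smul_eq_mul, hxc]
    linarith

/-- A face through the apex is determined by its section. -/
theorem face_subset (h : IsApex t v φ c) {L L' : Set (Fin n → ℝ)}
    (hL : IsFace (convexHull ℝ t) L) (hL' : IsFace (convexHull ℝ t) L') (hv : v ∈ L)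
    (hv' : v ∈ L') (hsub : L ∩ {x | φ x = c} ⊆ L') : L ⊆ L' := by
  obtain ⟨-, θ, hθ⟩ := isFace_iff.1 hL'
  have hL'conv : Convex ℝ L' := hθ ▸ convex_argmax (convex_convexHull ℝ t) θ
  have hLeq := hL.eq_convexHull
  rw [hLeq]
  refine convexHull_min (fun w hw => ?_) hL'conv
  by_cases hne : w = v
  · rwa [hne]
  obtain ⟨q, hq, r, hr, hqr⟩ := (h.inter hv).exists_section hw hne
  rw [← hLeq] at hq
  have hq' := hsub hq
  rw [hθ] at hv' hq' ⊢
  rw [argmax_eq hv'] at hq' ⊢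
  refine ⟨subset_convexHull ℝ _ hw.1, ?_⟩
  have h1 : θ w - θ v = r * (θ q - θ v) := by
    rw [← map_sub, ← map_sub, hqr, map_smul, smul_eq_mul]
  rw [hq'.2, sub_self, mul_zero, sub_eq_zero] at h1
  exact h1

theorem face_eq (h : IsApex t v φ c) {L L' : Set (Fin n → ℝ)}
    (hL : IsFace (convexHull ℝ t) L) (hL' : IsFace (convexHull ℝ t) L') (hv : v ∈ L)
    (hv' : v ∈ L') (heq : L ∩ {x | φ x = c} = L' ∩ {x | φ x = c}) : L = L' :=
  (h.face_subset hL hL' hv hv' (heq ▸ inter_subset_left)).antisymm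
    (h.face_subset hL' hL hv' hv (heq ▸ inter_subset_left))

theorem vectorSpan_eq (h : IsApex t v φ c) {g : Fin n → ℝ}
    (hg : g ∈ convexHull ℝ t ∩ {x | φ x = c}) :
    vectorSpan ℝ (convexHull ℝ t) =
      vectorSpan ℝ (convexHull ℝ t ∩ {x | φ x = c}) ⊔ Submodule.span ℝ {g - v} := by
  refine le_antisymm ?_ (sup_le (vectorSpan_mono ℝ inter_subset_left) ?_)
  · rw [vectorSpan_convexHull, vectorSpan_eq_span_vsub_set_right ℝ h.mem]
    refine Submodule.span_le.2 ?_
    rintro _ ⟨w, hw, rfl⟩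
    change w - v ∈ _
    by_cases hne : w = v
    · rw [hne, sub_self]
      exact Submodule.zero_mem _
    obtain ⟨q, hq, r, hr, hqr⟩ := h.exists_section hw hne
    rw [hqr, ← sub_add_sub_cancel q g v]
    exact Submodule.smul_mem _ _ (Submodule.add_mem _
      (Submodule.mem_sup_left (vsub_mem hq hg))
      (Submodule.mem_sup_right (Submodule.mem_span_singleton_self _)))
  · rw [Submodule.span_singleton_le_iff_mem]
    exact vsub_mem hg.1 h.mem_hull

theorem mem_vectorSpan_section (h : IsApex t v φ c)
    (hne : (convexHull ℝ t ∩ {x | φ x = c}).Nonempty) {u : Fin n → ℝ}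
    (hu : u ∈ vectorSpan ℝ (convexHull ℝ t)) (hφ : φ u = 0) :
    u ∈ vectorSpan ℝ (convexHull ℝ t ∩ {x | φ x = c}) := by
  obtain ⟨g, hg⟩ := hne
  rw [h.vectorSpan_eq hg] at hu
  obtain ⟨y, hy, z, hz, rfl⟩ := Submodule.mem_sup.1 hu
  obtain ⟨b, rfl⟩ := Submodule.mem_span_singleton.1 hz
  have h1 : φ y = 0 := mem_vectorSpan_eq_zero (fun x hx => hx.2) hy
  have h2 : φ g = c := hg.2
  rw [map_add, h1, zero_add, map_smul, map_sub, h2, smul_eq_mul] at hφ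
  have h3 : b = 0 := (mul_eq_zero.1 hφ).resolve_right (by linarith [h.lt])
  rwa [h3, zero_smul, add_zero]

theorem dim_eq (h : IsApex t v φ c) (hne : (convexHull ℝ t ∩ {x | φ x = c}).Nonempty) :
    dim (convexHull ℝ t) = dim (convexHull ℝ t ∩ {x | φ x = c}) + 1 := by
  obtain ⟨g, hg⟩ := hne
  rw [dim, h.vectorSpan_eq hg]
  refine Submodule.finrank_sup_span_singleton fun hmem => ?_
  have h1 : φ (g - v) = 0 := mem_vectorSpan_eq_zero (fun x hx => hx.2) hmem
  have h2 : φ g = c := hg.2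
  rw [map_sub, h2] at h1
  linarith [h.lt]

/-- The section is the convex hull of the points where the hyperplane meets the edges from the
apex to the other points of `t`. -/
theorem section_subset (h : IsApex t v φ c) {K : Set (Fin n → ℝ)} (hK : Convex ℝ K)
    (hne : K.Nonempty) (hφ : ∀ q ∈ K, φ q = c)
    (hcone : ∀ w ∈ t, w ≠ v → ∃ q ∈ K, ∃ r : ℝ, 0 ≤ r ∧ w - v = r • (q - v)) :
    convexHull ℝ t ∩ {x | φ x = c} ⊆ K := by
  have hsub : convexHull ℝ t ⊆ {x | ∃ q ∈ K, ∃ r : ℝ, 0 ≤ r ∧ x - v = r • (q - v)} := by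
    refine convexHull_min (fun w hw => ?_) ?_
    · by_cases hwv : w = v
      · obtain ⟨q, hq⟩ := hne
        exact ⟨q, hq, 0, le_rfl, by rw [hwv, sub_self, zero_smul]⟩
      · exact hcone w hw hwv
    · rintro x ⟨q₁, hq₁, r₁, hr₁, hx⟩ y ⟨q₂, hq₂, r₂, hr₂, hy⟩ a b ha hb hab
      have h1 := mul_nonneg ha hr₁
      have h2 := mul_nonneg hb hr₂
      have hcomb : a • x + b • y - v = (a * r₁) • (q₁ - v) + (b * r₂) • (q₂ - v) := by
        rw [mul_smul, mul_smul, ← hx, ← hy, smul_sub, smul_sub]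
        have : v = a • v + b • v := by rw [← add_smul, hab, one_smul]
        conv_lhs => rw [this]
        abel
      rcases (add_nonneg h1 h2).eq_or_lt with h0 | hpos
      · have h3 : a * r₁ = 0 := by linarith
        have h4 : b * r₂ = 0 := by linarith
        exact ⟨q₁, hq₁, 0, le_rfl, by rw [hcomb, h3, h4, zero_smul, zero_smul, add_zero]⟩
      · refine ⟨(a * r₁ / (a * r₁ + b * r₂)) • q₁ + (b * r₂ / (a * r₁ + b * r₂)) • q₂,
          hK hq₁ hq₂ (div_nonneg h1 hpos.le) (div_nonneg h2 hpos.le) ?_, a * r₁ + b * r₂,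
          hpos.le, ?_⟩
        · rw [← add_div, div_self hpos.ne']
        · rw [hcomb, smul_sub (a * r₁ + b * r₂), smul_add, smul_smul, smul_smul,
            mul_div_cancel₀ _ hpos.ne', mul_div_cancel₀ _ hpos.ne', smul_sub, smul_sub, add_smul]
          abel
  rintro x ⟨hx, hxc⟩
  obtain ⟨q, hq, r, -, hr⟩ := hsub hx
  have h1 : c - φ v = r * (c - φ v) := by
    have := congrArg φ hr
    rwa [map_sub, map_smul, map_sub, hφ q hq, show φ x = c from hxc, smul_eq_mul] at this
  have h2 : r = 1 := by
    have h3 : c - φ v ≠ 0 := by linarith [h.lt]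
    exact mul_right_cancel₀ h3 (by linarith)
  rw [h2, one_smul] at hr
  rwa [sub_left_injective hr]

theorem isPolytope_section (ht : t.Finite) (h : IsApex t v φ c) :
    IsPolytope (convexHull ℝ t ∩ {x | φ x = c}) := by
  classical
  have hex : ∀ w, ∃ q, w ∈ t → w ≠ v → q ∈ convexHull ℝ t ∩ {x | φ x = c} ∧
      ∃ r : ℝ, 0 < r ∧ w - v = r • (q - v) := by
    intro w
    by_cases hw : w ∈ t ∧ w ≠ v
    · obtain ⟨q, hq⟩ := h.exists_section hw.1 hw.2
      exact ⟨q, fun _ _ => hq⟩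
    · exact ⟨0, fun h1 h2 => absurd ⟨h1, h2⟩ hw⟩
  choose q hq using hex
  have hfin : (q '' (t \ {v})).Finite := (ht.subset sdiff_subset).image q
  have hqs : q '' (t \ {v}) ⊆ convexHull ℝ t ∩ {x | φ x = c} := by
    rintro _ ⟨w, hw, rfl⟩
    exact (hq w hw.1 hw.2).1
  refine ⟨hfin.toFinset, ?_⟩
  rw [Finite.coe_toFinset]
  rcases (t \ {v}).eq_empty_or_nonempty with hem | hne
  · rw [hem, image_empty, convexHull_empty, eq_empty_iff_forall_notMem]
    rintro x ⟨hx, hxc⟩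
    have hxc' : φ x = c := hxc
    refine (convexHull_lt (M := c) (fun w hw => ?_) x hx).ne hxc'
    have : w = v := by
      by_contra hwv
      exact (hem ▸ (⟨hw, hwv⟩ : w ∈ t \ {v}) : w ∈ (∅ : Set _))
    rw [this]
    exact h.lt
  · refine Subset.antisymm ?_ (convexHull_min hqs ((convex_convexHull ℝ t).inter
      (convex_hyperplane (LinearMap.isLinear φ) c)))
    refine h.section_subset (convex_convexHull ℝ _) (hne.image q).convexHull ?_ ?_
    · exact fun x hx => convexHull_min (fun y hy => (hqs hy).2)
        (convex_hyperplane (LinearMap.isLinear φ) c) hx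
    · intro w hw hwv
      obtain ⟨r, hr, hwr⟩ := (hq w hw hwv).2
      exact ⟨q w, subset_convexHull ℝ _ (mem_image_of_mem q ⟨hw, hwv⟩), r, hr.le, hwr⟩

end IsApex

theorem IsVertexFigureAt.exists_apex {P Q : Set (Fin n → ℝ)} {v : Fin n → ℝ} (hP : IsPolytope P)
    (h : IsVertexFigureAt P v Q) :
    ∃ (t : Finset (Fin n → ℝ)) (φ : Dual ℝ (Fin n → ℝ)) (c : ℝ), φ ≠ 0 ∧
      P = convexHull ℝ (t : Set (Fin n → ℝ)) ∧ IsApex (t : Set (Fin n → ℝ)) v φ c ∧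
      Q = P ∩ {x | φ x = c} := by
  obtain ⟨t, rfl, ht⟩ := hP.exists_vertices
  obtain ⟨hv, φ, c, hφ, hlt, hw, hQ⟩ := h
  exact ⟨t, φ, c, hφ, rfl, ⟨hv.mem_of_eq_convexHull, hlt, fun w hwt => hw w (ht w hwt)⟩, hQ⟩

/-- An admissible frame for a section by `{φ = c}` has vectors outside of `ker φ`. -/
theorem exists_apply_ne_zero {B : Frame n} {F : Set (Fin n → ℝ)} {φ : Dual ℝ (Fin n → ℝ)} {c : ℝ}
    (hφ : φ ≠ 0) (hF : ∀ x ∈ F, φ x = c) (hadm : AdmissibleAt B F) {k : ℕ} (hk : k < dim F) :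
    ∃ i : Fin n, k < i ∧ φ (B i) ≠ 0 := by
  by_contra hcon
  push Not at hcon
  have hp : ∀ x, φ (proj B (dim F) x) = φ x := apply_proj fun i hi => hcon i (by omega)
  refine hφ (LinearMap.ext fun x => ?_)
  obtain ⟨y, hy, hyx⟩ := hadm.surjOn (show proj B (dim F) x ∈
    (frameSpan B (dim F) : Set (Fin n → ℝ)) from proj_mem_frameSpan _ _ _)
  rw [← hp, ← hyx, hp]
  exact mem_vectorSpan_eq_zero hF hy

theorem exists_perm {k i : ℕ} (hk : k + 1 < n) (hi : i < n) (hki : k < i) :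
    ∃ σ : Equiv.Perm (Fin n), σ ⟨k + 1, hk⟩ = ⟨k, by omega⟩ ∧ σ ⟨k, by omega⟩ = ⟨i, hi⟩ ∧
      (∀ j : Fin n, k + 1 < (j : ℕ) → k < (σ j : ℕ)) ∧ ∀ j : Fin n, (j : ℕ) < k → σ j = j := by
  set κ : Fin n := ⟨k, by omega⟩ with hκ
  set κ' : Fin n := ⟨k + 1, hk⟩ with hκ'
  have hne : κ' ≠ κ := by simp [hκ, hκ']
  by_cases h : i = k + 1
  · refine ⟨Equiv.swap κ κ', Equiv.swap_apply_right _ _, ?_, fun j hj => ?_, fun j hj => ?_⟩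
    · rw [Equiv.swap_apply_left]
      exact Fin.ext h.symm
    · rw [Equiv.swap_apply_of_ne_of_ne]
      · omega
      · exact fun h => by simp [h, hκ] at hj
      · exact fun h => by simp [h, hκ'] at hj
    · rw [Equiv.swap_apply_of_ne_of_ne]
      · exact fun h => by simp [h, hκ] at hj
      · exact fun h => by simp [h, hκ'] at hj
  · have h1 : (⟨i, hi⟩ : Fin n) ≠ κ := fun h => by simp [hκ] at h; omega
    have h2 : (⟨i, hi⟩ : Fin n) ≠ κ' := fun h => by simp [hκ'] at h; omega
    refine ⟨Equiv.swap κ κ' * Equiv.swap κ ⟨i, hi⟩, ?_, ?_, fun j hj => ?_, fun j hj => ?_⟩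
    · rw [Equiv.Perm.mul_apply, Equiv.swap_apply_of_ne_of_ne hne h2.symm, Equiv.swap_apply_right]
    · rw [Equiv.Perm.mul_apply, Equiv.swap_apply_left, Equiv.swap_apply_of_ne_of_ne h1 h2]
    · rw [Equiv.Perm.mul_apply]
      have hjκ : j ≠ κ := fun h => by simp [h, hκ] at hj
      have hjκ' : j ≠ κ' := fun h => by simp [h, hκ'] at hj
      by_cases hji : j = ⟨i, hi⟩
      · rw [hji, Equiv.swap_apply_right, Equiv.swap_apply_left]
        simp [hκ']
      · rw [Equiv.swap_apply_of_ne_of_ne hjκ hji, Equiv.swap_apply_of_ne_of_ne hjκ hjκ']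
        omega
    · rw [Equiv.Perm.mul_apply]
      have hjκ : j ≠ κ := fun h => by simp [h, hκ] at hj
      have hjκ' : j ≠ κ' := fun h => by simp [h, hκ'] at hj
      have hji : j ≠ ⟨i, hi⟩ := fun h => by simp [h] at hj; omega
      rw [Equiv.swap_apply_of_ne_of_ne hjκ hji, Equiv.swap_apply_of_ne_of_ne hjκ hjκ']

/-- If a vertex figure admits a frame inducing a `k`-loop, then the polytope admits a frame
inducing a `(k + 1)`-loop. -/
theorem admitsLoop_of_vertexFigure {P Q : Set (Fin n → ℝ)} {v : Fin n → ℝ} (hP : IsPolytope P)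
    (hfig : IsVertexFigureAt P v Q) {k : ℕ} (h : AdmitsLoop Q k) : AdmitsLoop P (k + 1) := by
  obtain ⟨t, φ, c, hφ, rfl, hapex, rfl⟩ := hfig.exists_apex hP
  obtain ⟨B, hadm, hloop⟩ := h
  have hQpoly : IsPolytope (convexHull ℝ (t : Set (Fin n → ℝ)) ∩ {x | φ x = c}) :=
    hapex.isPolytope_section t.finite_toSet
  obtain ⟨i, hi, hφi⟩ : ∃ i : Fin n, k < i ∧ φ (B i) ≠ 0 := by
    obtain ⟨m, F, hF, i, -⟩ := hloop
    exact exists_apply_ne_zero hφ (fun x hx => ((hF.1 i).1.subset hx).2) (hadm _ (hF.1 i).1)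
      (hF.1 i).2
  have hk1 : k + 1 < n := lt_of_le_of_lt hi i.2
  have hk : k < n := by omega
  obtain ⟨m, F, hF, hE, hrep⟩ := hloop.openLoop hk hQpoly hadm
  -- lift the faces
  have hlift : ∀ G, IsFace (convexHull ℝ (t : Set (Fin n → ℝ)) ∩ {x | φ x = c}) G →
      ∃ L, IsFace (convexHull ℝ (t : Set (Fin n → ℝ))) L ∧ v ∈ L ∧ L ∩ {x | φ x = c} = G := by
    intro G hG
    obtain ⟨hne, ψ, rfl⟩ := isFace_iff.1 hG
    obtain ⟨a, hv, heq⟩ := hapex.exists_lift hne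
    exact ⟨_, hP.isFace_argmax ⟨v, hapex.mem_hull⟩ _, hv, heq⟩
  choose! L hLface hLv hLsec using hlift
  have hLapex : ∀ G, IsFace (convexHull ℝ (t : Set (Fin n → ℝ)) ∩ {x | φ x = c}) G →
      IsApex ((t : Set (Fin n → ℝ)) ∩ L G) v φ c ∧
        L G = convexHull ℝ ((t : Set (Fin n → ℝ)) ∩ L G) :=
    fun G hG => ⟨hapex.inter (hLv G hG), (hLface G hG).eq_convexHull⟩
  have hLdim : ∀ G, IsFace (convexHull ℝ (t : Set (Fin n → ℝ)) ∩ {x | φ x = c}) G →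
      dim (L G) = dim G + 1 := by
    intro G hG
    obtain ⟨h1, h2⟩ := hLapex G hG
    have h3 := h1.dim_eq (by rw [← h2, hLsec G hG]; exact hG.1)
    rwa [← h2, hLsec G hG] at h3
  have hLspan : ∀ G, IsFace (convexHull ℝ (t : Set (Fin n → ℝ)) ∩ {x | φ x = c}) G →
      ∀ u ∈ vectorSpan ℝ (L G), φ u = 0 → u ∈ vectorSpan ℝ G := by
    intro G hG u hu hu0
    obtain ⟨h1, h2⟩ := hLapex G hG
    rw [h2] at hu
    have h3 := h1.mem_vectorSpan_section (by rw [← h2, hLsec G hG]; exact hG.1) hu hu0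
    rwa [← h2, hLsec G hG] at h3
  -- the tuple
  obtain ⟨σ, hσ1, hσ2, hσ3, hσ4⟩ := exists_perm hk1 i.2 hi
  let B' : Fin n → (Fin n → ℝ) := fun j => B (σ j) - (φ (B (σ j)) / φ (B i)) • B i
  have hφB' : ∀ j, φ (B' j) = 0 := by
    intro j
    simp only [B', map_sub, map_smul, smul_eq_mul]
    rw [div_mul_cancel₀ _ hφi, sub_self]
  have htr : ∀ E, IsFace (convexHull ℝ (t : Set (Fin n → ℝ)) ∩ {x | φ x = c}) E →
      Transversal B k E → Transversal B' (k + 1) (L E) := by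
    intro E hEf hEtr c' hc' hmem
    have h1 := hLspan E hEf _ hmem (by
      rw [map_sum]
      exact Finset.sum_eq_zero fun j _ => by rw [map_smul, hφB', smul_zero])
    set μ := ∑ j, c' j * (φ (B (σ j)) / φ (B i)) with hμ
    have hsum : ∑ j, c' j • B' j =
        ∑ l, (c' (σ.symm l) - if l = i then μ else 0) • B l := by
      have h2 : ∑ j, c' j • B' j = ∑ j, c' j • B (σ j) - μ • B i := by
        rw [hμ, Finset.sum_smul, ← Finset.sum_sub_distrib]
        exact Finset.sum_congr rfl fun j _ => by rw [smul_sub, smul_smul]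
      have h3 : ∑ l, c' (σ.symm l) • B l = ∑ j, c' j • B (σ j) := by
        rw [← Equiv.sum_comp σ]
        simp
      rw [h2, ← h3]
      simp only [sub_smul, Finset.sum_sub_distrib, ite_smul, zero_smul, Finset.sum_ite_eq',
        Finset.mem_univ, if_true]
    rw [hsum] at h1
    have h4 := hEtr _ (fun j hj => ?_) h1
    · ext j
      rcases Nat.lt_or_ge j (k + 1) with hj | hj
      · exact hc' j hj
      · have h5 := congrFun h4 (σ j)
        have h6 : σ j ≠ i := by
          intro h
          have : j = ⟨k, hk⟩ := σ.injective (h.trans hσ2.symm)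
          rw [this] at hj
          simp at hj
        simpa [h6] using h5
    · have h5 : σ.symm j = j := by
        rw [Equiv.symm_apply_eq, hσ4 j hj]
      rw [h5, hc' j (by omega), if_neg (fun h => by rw [h] at hj; omega), sub_zero]
  have hside : ∀ (s : ℝ) (F E : Set (Fin n → ℝ)),
      IsFace (convexHull ℝ (t : Set (Fin n → ℝ)) ∩ {x | φ x = c}) F → IsFace F E →
      Side s B ⟨k, hk⟩ F E →
      Side s B' ⟨k + 1, hk1⟩ (L F) (L E) ∧ IsFace (L F) (L E) := by
    intro s F E hFf hEf ⟨θ, hpos, hzero, hθ⟩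
    obtain ⟨h1, h2⟩ := hLapex F hFf
    have hE' := hFf.trans hQpoly hEf
    have hFsec : convexHull ℝ ((t : Set (Fin n → ℝ)) ∩ L F) ∩ {x | φ x = c} = F := by
      rw [← h2, hLsec F hFf]
    obtain ⟨a, hva, hsec⟩ := h1.exists_lift (ψ := θ) (by rw [hFsec, ← hθ]; exact hEf.1)
    rw [hFsec, ← hθ, ← h2] at hsec
    rw [← h2] at hva
    have hA : IsFace (L F) (argmax (L F) (θ + a • φ)) := isFace_iff.2 ⟨⟨v, hva⟩, _, rfl⟩
    have hAeq : L E = argmax (L F) (θ + a • φ) :=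
      hapex.face_eq (hLface E hE') ((hLface F hFf).trans hP hA) (hLv E hE') hva
        (by rw [hLsec E hE', hsec])
    refine ⟨⟨θ + a • φ, ?_, fun j hj => ?_, hAeq⟩, hAeq ▸ hA⟩
    · have : (θ + a • φ) (B' ⟨k + 1, hk1⟩) = θ (B ⟨k, hk⟩) := by
        rw [LinearMap.add_apply, LinearMap.smul_apply, hφB', smul_zero, add_zero]
        simp only [B', hσ1, map_sub, map_smul, hzero i hi, smul_zero, sub_zero]
      rwa [this]
    · rw [LinearMap.add_apply, LinearMap.smul_apply, hφB', smul_zero, add_zero]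
      simp only [B', map_sub, map_smul, hzero i hi, hzero (σ j) (hσ3 j hj), smul_zero, sub_zero]
  refine OpenLoop.admitsLoop (k := ⟨k + 1, hk1⟩) (B₀ := B') hP ⟨m, fun j => L (F j),
    fun j => ⟨hLface _ (hF j).1, ?_⟩, fun j l hjl => ?_, ?_⟩
  · have h1 := (hF j).2
    rw [hLdim _ (hF j).1]
    exact Nat.succ_lt_succ h1
  · obtain ⟨E, h1, h2, h3, h4, h5, h6⟩ := hE j l hjl
    have hEf := (hF j).1.trans hQpoly h1
    have h7 := hside 1 _ _ (hF j).1 h1 h5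
    have h8 := hside (-1) _ _ (hF l).1 h2 h6
    exact ⟨L E, h7.2, h8.2, by rw [hLdim E hEf, h3], htr E hEf h4, h7.1, h8.1⟩
  · obtain ⟨j, l, hjl, heq⟩ := hrep
    exact ⟨j, l, hjl, congrArg L heq⟩

theorem IsSimplex.exists_points {S : Set (Fin n → ℝ)} (hS : IsSimplex S) (hd : 5 ≤ dim S) :
    ∃ p : Fin 6 → (Fin n → ℝ), AffineIndependent ℝ p ∧ IsFace S (subsimplex p Finset.univ) := by
  obtain ⟨m, p, hp, rfl⟩ := hS
  have hm : 6 ≤ m := by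
    rcases m with _ | m
    · rw [dim, range_eq_empty, convexHull_empty, vectorSpan_empty, finrank_bot] at hd
      omega
    · rw [← subsimplex_univ, dim_subsimplex hp (d := m) (by simp)] at hd
      omega
  refine ⟨p ∘ Fin.castLE hm, hp.comp_embedding (Fin.castLEEmb hm), ?_⟩
  have : subsimplex (p ∘ Fin.castLE hm) Finset.univ =
      subsimplex p (Finset.univ.map (Fin.castLEEmb hm)) := by
    rw [subsimplex, subsimplex, image_comp, Finset.coe_map]
    rfl
  rw [this, ← subsimplex_univ]
  exact isFace_subsimplex hp (by simp) (Finset.subset_univ _)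

theorem admitsLoop_of_simplex_face {P S : Set (Fin n → ℝ)} (hP : IsPolytope P) (hS : IsFace P S)
    (hS' : IsSimplex S) (hd : 5 ≤ dim S) : ∃ k, AdmitsLoop P k := by
  obtain ⟨p, hp, hface⟩ := hS'.exists_points hd
  exact admitsLoop_of_simplex hP hp (hS.trans hP hface)

/-- A polytope of positive dimension has a vertex figure, of one dimension less. -/
theorem IsPolytope.exists_vertexFigure {P : Set (Fin n → ℝ)} (hP : IsPolytope P)
    (hd : 0 < dim P) :
    ∃ v Q, IsVertexFigureAt P v Q ∧ IsPolytope Q ∧ Q.Nonempty ∧ dim P = dim Q + 1 := by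
  obtain ⟨t, rfl, ht⟩ := hP.exists_vertices
  obtain ⟨v, hvt⟩ : t.Nonempty := by
    rw [Finset.nonempty_iff_ne_empty]
    rintro rfl
    rw [Finset.coe_empty, convexHull_empty, dim, vectorSpan_empty, finrank_bot] at hd
    exact lt_irrefl _ hd
  obtain ⟨w, hwt, hwv⟩ : ∃ w ∈ t, w ≠ v := by
    by_contra hcon
    push Not at hcon
    have : t = {v} := Finset.eq_singleton_iff_unique_mem.2 ⟨hvt, hcon⟩
    rw [this, Finset.coe_singleton, convexHull_singleton, dim, vectorSpan_singleton,
      finrank_bot] at hd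
    exact lt_irrefl _ hd
  obtain ⟨-, ψ, hψ⟩ := isFace_iff.1 (ht v hvt)
  have hv : v ∈ argmax (convexHull ℝ (t : Set (Fin n → ℝ))) ψ := hψ ▸ mem_singleton v
  have hlt : ∀ u ∈ t, u ≠ v → (-ψ) v < (-ψ) u := by
    intro u hu hne
    rw [LinearMap.neg_apply, LinearMap.neg_apply, neg_lt_neg_iff]
    refine lt_of_le_of_ne (hv.2 u (subset_convexHull ℝ _ hu)) fun h => hne ?_
    have : u ∈ argmax (convexHull ℝ (t : Set (Fin n → ℝ))) ψ := by
      rw [argmax_eq hv]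
      exact ⟨subset_convexHull ℝ _ hu, h⟩
    rwa [← hψ] at this
  obtain ⟨c, hc, hc'⟩ : ∃ c, (∀ u ∈ t, u ≠ v → c < (-ψ) u) ∧ (-ψ) v < c := by
    have hev : ∀ᶠ c in 𝓝[>] ((-ψ) v), ∀ u ∈ t, u ≠ v → c < (-ψ) u := by
      rw [Finset.eventually_all]
      intro u hu
      by_cases hne : u = v
      · exact Eventually.of_forall fun _ h => absurd hne h
      · filter_upwards [mem_nhdsWithin_of_mem_nhds (Iio_mem_nhds (hlt u hu hne))] with c hc _
          using hc
    exact (hev.and self_mem_nhdsWithin).exists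
  have hapex : IsApex (t : Set (Fin n → ℝ)) v (-ψ) c := ⟨hvt, hc', hc⟩
  obtain ⟨q, hq, -⟩ := hapex.exists_section hwt hwv
  refine ⟨v, _, ⟨ht v hvt, -ψ, c, ?_, hc', fun u hu hne => hc u hu.mem_of_eq_convexHull hne, rfl⟩,
    hapex.isPolytope_section t.finite_toSet, ⟨q, hq⟩, hapex.dim_eq ⟨q, hq⟩⟩
  intro h0
  have := hlt w hwt hwv
  rw [h0] at this
  exact lt_irrefl _ this

end FramedPolytope

theorem mainTheorem11 :
    (∀ (n : ℕ) (P : Set (Fin n → ℝ)), FramedPolytope.IsPolytope P →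
      (∃ F, FramedPolytope.IsFace P F ∧ FramedPolytope.IsSimplex F ∧ FramedPolytope.dim F = 5) →
        ∃ k, FramedPolytope.AdmitsLoop P k) ∧
    (∀ (n : ℕ) (P : Set (Fin n → ℝ)), FramedPolytope.IsSimplicial P →
      6 ≤ FramedPolytope.dim P → ∃ k, FramedPolytope.AdmitsLoop P k) ∧
    (∀ (n : ℕ) (P : Set (Fin n → ℝ)), FramedPolytope.IsPolytope P →
      ∀ v Q, FramedPolytope.IsVertexFigureAt P v Q →
        ∀ k, FramedPolytope.AdmitsLoop Q k → FramedPolytope.AdmitsLoop P (k + 1)) ∧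
    (∀ (n : ℕ) (P : Set (Fin n → ℝ)), FramedPolytope.IsSimple P →
      6 ≤ FramedPolytope.dim P → ∃ k, FramedPolytope.AdmitsLoop P k) := by
  refine ⟨fun n P hP => ?_, fun n P hP hd => ?_, fun n P hP v Q hQ k hk => ?_, fun n P hP hd => ?_⟩
  · rintro ⟨F, hF, hS, hd⟩
    exact FramedPolytope.admitsLoop_of_simplex_face hP hF hS hd.ge
  · obtain ⟨F, hF⟩ := hP.1.exists_facet (by omega)
    exact FramedPolytope.admitsLoop_of_simplex_face hP.1 hF.1 (hP.2 F hF)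
      (by have := hF.2; omega)
  · exact FramedPolytope.admitsLoop_of_vertexFigure hP hQ hk
  · obtain ⟨v, Q, hQ, hQpoly, hne, hdim⟩ := hP.1.exists_vertexFigure (by omega)
    obtain ⟨k, hk⟩ := FramedPolytope.admitsLoop_of_simplex_face hQpoly
      (FramedPolytope.IsFace.self hne) (hP.2 v Q hQ) (by omega)
    exact ⟨k + 1, FramedPolytope.admitsLoop_of_vertexFigure hP.1 hQ hk⟩
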